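/- Let $M\ge 1$ be an integer and let $\Omega_M=\{0,1,\dots,M\}^{\mathbb N}$ be ordered lexicographically, with left shift $\sigma$. For $q\in(1,M+1]$ and $(x_i)\in\Omega_M$ put $\pi_q((x_i))=\sum_{i\ge1}x_iq^{-i}$; $(x_i)$ is called a $q$-expansion of $\pi_q((x_i))$. Let $\mathcal U_q$ be the set of reals having exactly one $q$-expansion, let $\mathbf U_q=\{(x_i)\in\Omega_M:\pi_q((x_i))\in\mathcal U_q\}$, and let $q_{KL}=q_{KL}(M)$ be the smallest $q\in(1,M+1]$ with $1\in\mathcal U_q$. Let $$H(q)=\lim_{n\to\infty}\frac{\log\#B_n(\mathbf U_q)}{n},$$ where $B_n(\mathbf U_q)$ is the set of length-$n$ prefixes of sequences in $\mathbf U_q$. Let $\alpha(q)$ be the quasi-greedy $q$-expansion of $1$, that is, the lexicographically largest $q$-expansion of $1$ not ending with $0^\infty$. Write $\overline{d}=M-d$ for digits, extended digitwise to words and sequences; for a word $w$, let $w^{+}$ (resp. $w^{-}$) be $w$ with its last digit increased (resp. decreased) by $1$, when the result is again a word over $\{0,\dots,M\}$; and let $w^\infty=www\cdots$. Let $\mathcal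 V$ be the set of all $c\in\Omega_M$ with $\overline{c}\preceq\sigma^n(c)\preceq c$ for all $n\ge0$. A sequence $(a_i)\in\mathcal V$ is irreducible if for every $j\ge1$ with $a_j>0$ and $(a_1\cdots a_j^-)^\infty\in\mathcal V$ one has $a_1\cdots a_j\,(\overline{a_1\cdots a_j}^{\,+})^\infty\prec(a_i)$. An interval $[p_L,p_R]\subset(q_{KL},M+1]$ is irreducible if $\alpha(p_L)$ is irreducible and there is a word $a_1\cdots a_m$ with $m\ge1$ and $a_m<M$ such that $$\alpha(p_L)=(a_1\cdots a_m)^\infty,\qquad \alpha(p_R)=a_1\cdots a_m^+\,(\overline{a_1\cdots a_m})^\infty.$$ **Proposition.** If $[p_L,p_R]$ is an irreducible interval in $(q_{KL},M+1]$, then the limits defining $H(p_L)$ and $H(p_R)$ exist and $H(p_R)=H(p_L)$. -/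

import Mathlib

open Filter Topology

namespace BetaExp

/-- Infinite sequences of digits in the alphabet `{0, 1, …, M}`.  Positions are counted from `0`,
so `x i` is the digit written `x_{i+1}` when one counts from `1`. -/
abbrev DigitSeq (M : ℕ) : Type := ℕ → Fin (M + 1)

/-- Words of length `k + 1` (that is, non-empty words) in the alphabet `{0, 1, …, M}`. -/
abbrev Word (M k : ℕ) : Type := Fin (k + 1) → Fin (M + 1)

section Lexicographic

variable {M : ℕ}

/-- Strict lexicographical order on sequences. -/
def LexLT (c d : DigitSeq M) : Prop := toLex c < toLex d

/-- Non-strict lexicographical order on sequences. -/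
def LexLE (c d : DigitSeq M) : Prop := toLex c ≤ toLex d

theorem lexLT_iff (c d : DigitSeq M) :
    LexLT c d ↔ ∃ n, (∀ i < n, c i = d i) ∧ c n < d n := Iff.rfl

theorem lexLE_iff (c d : DigitSeq M) : LexLE c d ↔ LexLT c d ∨ c = d :=
  le_iff_lt_or_eq (a := toLex c) (b := toLex d)

end Lexicographic

section Words

variable {M k : ℕ}

/-- The `n`-fold left shift `σ^n`. -/
def shift (n : ℕ) (x : DigitSeq M) : DigitSeq M := fun i => x (n + i)

/-- Reflection of a sequence: each digit `d` becomes `M - d`. -/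
def reflSeq (x : DigitSeq M) : DigitSeq M := fun i => (x i).rev

/-- Reflection of a word: each digit `d` becomes `M - d`. -/
def refl (w : Word M k) : Word M k := fun i => (w i).rev

/-- `w⁺`: the last digit is increased by one (used only when the last digit is `< M`). -/
def plus (w : Word M k) : Word M k :=
  Function.update w (Fin.last k) (w (Fin.last k) + 1)

/-- `w⁻`: the last digit is decreased by one (used only when the last digit is `> 0`). -/
def minus (w : Word M k) : Word M k :=
  Function.update w (Fin.last k) (w (Fin.last k) - 1)

/-- The periodic sequence `w^∞ = w w w …`. -/
def rep (w : Word M k) : DigitSeq M :=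
  fun n => w ⟨n % (k + 1), Nat.mod_lt n (Nat.succ_pos k)⟩

/-- The concatenation of the word `w` and the sequence `x`. -/
def append (w : Word M k) (x : DigitSeq M) : DigitSeq M :=
  fun n => if h : n < k + 1 then w ⟨n, h⟩ else x (n - (k + 1))

/-- The prefix of length `k + 1` of a sequence. -/
def initial (x : DigitSeq M) (k : ℕ) : Word M k := fun i => x i

end Words

section Expansions

/-- `π_q(x) = ∑_{i ≥ 1} x_i / q^i`. The series converges for every `q > 1`. -/
noncomputable def expansionValue {M : ℕ} (q : ℝ) (x : DigitSeq M) : ℝ :=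
  ∑' i : ℕ, ((x i : ℕ) : ℝ) / q ^ (i + 1)

/-- `𝒰_q`: the real numbers that have exactly one `q`-expansion over `{0, …, M}`. -/
def univoqueSet (M : ℕ) (q : ℝ) : Set ℝ :=
  {y | ∃! x : DigitSeq M, expansionValue q x = y}

/-- The symbolic univoque set: the sequences whose value lies in `𝒰_q`. -/
def symbolicUnivoqueSet (M : ℕ) (q : ℝ) : Set (DigitSeq M) :=
  {x | expansionValue q x ∈ univoqueSet M q}

/-- The set of bases `q ∈ (1, M + 1]` in which `1` has a unique expansion. -/
def univoqueBases (M : ℕ) : Set ℝ :=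
  {q | 1 < q ∧ q ≤ M + 1 ∧ (1 : ℝ) ∈ univoqueSet M q}

/-- The Komornik–Loreti constant: the smallest base in which `1` has a unique expansion. -/
noncomputable def qKL (M : ℕ) : ℝ := sInf (univoqueBases M)

/-- The sequence ends with `0^∞`. -/
def EndsInZeros {M : ℕ} (x : DigitSeq M) : Prop := ∃ N, ∀ n, N ≤ n → x n = 0

/-- `a = α(q)` is the quasi-greedy `q`-expansion of `1`: the lexicographically largest
`q`-expansion of `1` that does not end with `0^∞`. -/
def IsQuasiGreedy {M : ℕ} (q : ℝ) (a : DigitSeq M) : Prop :=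
  (expansionValue q a = 1 ∧ ¬ EndsInZeros a) ∧
    ∀ b : DigitSeq M, expansionValue q b = 1 → ¬ EndsInZeros b → LexLE b a

end Expansions

section Entropy

variable {M : ℕ}

/-- `B_n(X)`: the set of length `n` prefixes of sequences from `X`. -/
def prefixes (X : Set (DigitSeq M)) (n : ℕ) : Set (Fin n → Fin (M + 1)) :=
  (fun x i => x i) '' X

/-- The quantities `log #B_n(X) / n` (natural logarithm). -/
noncomputable def growthRate (X : Set (DigitSeq M)) (n : ℕ) : ℝ :=
  Real.log ((prefixes X n).ncard : ℝ) / n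

/-- Topological entropy `h(X) = lim_n log #B_n(X) / n`, meaningful when the limit exists. -/
noncomputable def entropy (X : Set (DigitSeq M)) : ℝ := limUnder atTop (growthRate X)

/-- The limit defining the topological entropy of `X` exists. -/
def EntropyExists (X : Set (DigitSeq M)) : Prop :=
  ∃ h : ℝ, Tendsto (growthRate X) atTop (𝓝 h)

end Entropy

/-- The entropy function `H(q)`: the topological entropy of the symbolic univoque set. -/
noncomputable def entropyFunction (M : ℕ) (q : ℝ) : ℝ := entropy (symbolicUnivoqueSet M q)

section Irreducible

/-- The set of sequences `c` with `reflection of c ≼ σ^n(c) ≼ c` for all `n ≥ 0`. -/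
def admissibleSeqs (M : ℕ) : Set (DigitSeq M) :=
  {c | ∀ n, LexLE (reflSeq c) (shift n c) ∧ LexLE (shift n c) c}

/-- Irreducible sequences. With `j = k + 1 ≥ 1` and `w = a_1 … a_j`: if `a_j > 0` and
`(w⁻)^∞` is admissible, then `w (reflection of w)⁺ (reflection of w)⁺ … ≺ a`. -/
def IsIrreducibleSeq {M : ℕ} (a : DigitSeq M) : Prop :=
  a ∈ admissibleSeqs M ∧
    ∀ k : ℕ, 0 < a k → rep (minus (initial a k)) ∈ admissibleSeqs M →
      LexLT (append (initial a k) (rep (plus (refl (initial a k))))) a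

/-- `[pL, pR]` is an irreducible interval contained in `(q_KL, M + 1]`: `α(pL)` is irreducible and,
for some non-empty word `w` whose last digit is `< M`, `α(pL) = w^∞` and
`α(pR) = w⁺ (reflection of w)^∞`. -/
def IsIrreducibleInterval (M : ℕ) (pL pR : ℝ) : Prop :=
  (qKL M < pL ∧ pL ≤ pR ∧ pR ≤ M + 1) ∧
    ∃ (k : ℕ) (w : Word M k), w (Fin.last k) < Fin.last M ∧
      IsQuasiGreedy pL (rep w) ∧ IsIrreducibleSeq (rep w) ∧
      IsQuasiGreedy pR (append (plus w) (rep (refl w)))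

end Irreducible

end BetaExp

/-! Write `a` for α(p_L) = w^∞, `a'` for α(p_R) = w⁺ followed by the reflection of w^∞, and m for
the length of w. For a base q with quasi-greedy expansion α(q), the set 𝐔_q contains `band` of α(q)
(`band_subset_univoque`). Conversely, a sequence of 𝐔_q is a run of 0 or of M that either never ends
or leads, after one more digit, into that band (`exists_band_tail`). So the growth of the bands
decides everything, and since `band a ⊆ band a'` it remains to bound `band a'` by the growth rate h
of `band a`.

A member of `band a'` leaves the conditions of `band a` at a first place n, where its tail or the
reflected tail is at least `a`. From there it is squeezed between `a` and `a'`, so each further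
block of m letters has at most two values (`upperBand_block`), giving rate log 2 / m. Before n it is
a prefix of a member of `band a`, possibly followed by a stretch copied from the reflection of `a`
(`exists_band_prefix`). Summing over n is a convolution, which keeps the larger of the two rates
(`GrowsAtMost.conv`), so log 2 / m ≤ h suffices.

Irreducibility is used twice. It prevents any shift of `a` from being the reflection of `a`
(`shift_ne_reflSeq_of_isIrreducibleSeq`); hence `band a` has a member starting with w
(`exists_mem_band_agree`), which serves to complete prefixes. It also puts `a` above (K+1)K^∞ if M =
2K, and above (K+1)(K+1)(K(K+1))^∞ if M = 2K+1; below these there is room to code free bits, which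
gives log 2 / m ≤ h (`exists_two_pow_le`, `log_two_div_le`). The assumption p_L > q_KL enters
through p_L > 1 and the first two digits of `a`. -/

namespace BetaExp

/-! ### Lexicographic order, reflection, shift and gluing. -/

section LexLemmas

variable {M : ℕ} {a b c d x y z : DigitSeq M}

theorem LexLT.trans (h : LexLT a b) (h' : LexLT b c) : LexLT a c := lt_trans (α := Lex _) h h'

theorem LexLT.trans_le (h : LexLT a b) (h' : LexLE b c) : LexLT a c :=
  lt_of_lt_of_le (α := Lex _) h h'

theorem LexLE.trans_lt (h : LexLE a b) (h' : LexLT b c) : LexLT a c :=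
  lt_of_le_of_lt (α := Lex _) h h'

theorem LexLE.trans (h : LexLE a b) (h' : LexLE b c) : LexLE a c := le_trans (α := Lex _) h h'

theorem LexLE.refl (a : DigitSeq M) : LexLE a a := le_refl (α := Lex _) _

theorem LexLT.le (h : LexLT a b) : LexLE a b := le_of_lt (α := Lex _) h

theorem LexLT.irrefl (a : DigitSeq M) : ¬ LexLT a a := lt_irrefl (α := Lex _) _

theorem not_lexLT : ¬ LexLT a b ↔ LexLE b a := not_lt (α := Lex _)

theorem not_lexLE : ¬ LexLE a b ↔ LexLT b a := not_le (α := Lex _)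

theorem LexLE.antisymm (h : LexLE a b) (h' : LexLE b a) : a = b := le_antisymm (α := Lex _) h h'

theorem LexLT.exists_first (h : LexLT a b) : ∃ n, (∀ i < n, a i = b i) ∧ a n < b n := h

theorem lexLT_of (n : ℕ) (h : ∀ i < n, a i = b i) (h' : a n < b n) : LexLT a b := ⟨n, h, h'⟩

theorem lexLE_of_forall (h : ∀ n, (∀ i < n, a i = b i) → a n ≤ b n) : LexLE a b := by
  rw [← not_lexLT]
  rintro ⟨n, h1, h2⟩
  exact absurd (h n fun i hi => (h1 i hi).symm) (not_le.2 h2)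

theorem LexLE.apply_le (h : LexLE a b) {n : ℕ} (h' : ∀ i < n, a i = b i) : a n ≤ b n := by
  by_contra hc
  exact LexLT.irrefl _ (LexLE.trans_lt h (lexLT_of n (fun i hi => (h' i hi).symm) (not_le.1 hc)))

@[simp] theorem reflSeq_apply (x : DigitSeq M) (i : ℕ) : reflSeq x i = (x i).rev := rfl

@[simp] theorem shift_apply (n : ℕ) (x : DigitSeq M) (i : ℕ) : shift n x i = x (n + i) := rfl

@[simp] theorem reflSeq_reflSeq (x : DigitSeq M) : reflSeq (reflSeq x) = x := by
  funext i; simp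

@[simp] theorem shift_zero (x : DigitSeq M) : shift 0 x = x := by funext i; simp

theorem shift_shift (m n : ℕ) (x : DigitSeq M) : shift m (shift n x) = shift (n + m) x := by
  funext i; simp [add_assoc]

theorem shift_reflSeq (n : ℕ) (x : DigitSeq M) : shift n (reflSeq x) = reflSeq (shift n x) := rfl

theorem lexLT_reflSeq : LexLT (reflSeq a) (reflSeq b) ↔ LexLT b a := by
  simp only [lexLT_iff, reflSeq_apply, Fin.rev_inj, Fin.rev_lt_rev]
  simp only [eq_comm]

theorem lexLE_reflSeq : LexLE (reflSeq a) (reflSeq b) ↔ LexLE b a := by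
  rw [← not_lexLT, lexLT_reflSeq, not_lexLT]

theorem lexLT_reflSeq_left : LexLT (reflSeq a) b ↔ LexLT (reflSeq b) a := by
  rw [← lexLT_reflSeq, reflSeq_reflSeq]

theorem lexLE_reflSeq_left : LexLE (reflSeq a) b ↔ LexLE (reflSeq b) a := by
  rw [← lexLE_reflSeq, reflSeq_reflSeq]

theorem lexLT_shift_iff {n : ℕ} (h : ∀ i < n, a i = b i) :
    LexLT (shift n a) (shift n b) ↔ LexLT a b := by
  constructor
  · intro hl
    obtain ⟨j, h1, h2⟩ := hl.exists_first
    refine ⟨n + j, fun i hi => ?_, h2⟩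
    rcases lt_or_ge i n with hn | hn
    · exact h i hn
    · obtain ⟨t, rfl⟩ := Nat.exists_eq_add_of_le hn
      exact h1 t (by omega)
  · intro hl
    obtain ⟨j, h1, h2⟩ := hl.exists_first
    have hj : n ≤ j := by
      by_contra hc
      rw [h j (by omega)] at h2
      exact lt_irrefl _ h2
    obtain ⟨t, rfl⟩ := Nat.exists_eq_add_of_le hj
    exact ⟨t, fun i hi => h1 _ (by omega), h2⟩

theorem lexLE_shift_iff {n : ℕ} (h : ∀ i < n, a i = b i) :
    LexLE (shift n a) (shift n b) ↔ LexLE a b := by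
  rw [← not_lexLT, ← not_lexLT, lexLT_shift_iff fun i hi => (h i hi).symm]

/-- If `a ≺ b` and `a`, `b` do not agree on the first `n` letters, then any sequence that agrees
with `a` on these letters is `≺ b`. -/
theorem LexLT.of_agree (h : LexLT a b) {n : ℕ} (hn : ¬ ∀ i < n, a i = b i)
    (hc : ∀ i < n, c i = a i) : LexLT c b := by
  obtain ⟨j, h1, h2⟩ := h.exists_first
  have hj : j < n := by
    by_contra hj
    exact hn fun i hi => h1 i (by omega)
  exact lexLT_of j (fun i hi => (hc i (by omega)).trans (h1 i hi)) (by rw [hc j hj]; exact h2)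

/-- The first `n` letters of `u` followed by `y`. -/
def cat (n : ℕ) (u y : DigitSeq M) : DigitSeq M := fun i => if i < n then u i else y (i - n)

theorem cat_of_lt {n i : ℕ} (h : i < n) : cat n x y i = x i := by simp [cat, h]

theorem cat_add (n i : ℕ) : cat n x y (n + i) = y i := by simp [cat]

theorem shift_cat (n : ℕ) : shift n (cat n x y) = y := by funext i; simp [cat_add]

theorem shift_cat_of_le {n p : ℕ} (h : p ≤ n) :
    shift p (cat n x y) = cat (n - p) (shift p x) y := by
  funext i
  simp only [shift_apply, cat]
  by_cases hi : p + i < n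
  · rw [if_pos hi, if_pos (by omega)]
  · rw [if_neg hi, if_neg (by omega)]
    congr 1
    omega

theorem shift_cat_of_ge {n p : ℕ} (h : n ≤ p) : shift p (cat n x y) = shift (p - n) y := by
  funext i
  simp only [shift_apply, cat]
  rw [if_neg (by omega)]
  congr 1
  omega

theorem reflSeq_cat (n : ℕ) : reflSeq (cat n x y) = cat n (reflSeq x) (reflSeq y) := by
  funext i
  simp only [reflSeq_apply, cat]
  split_ifs <;> rfl

/-- The sequences all of whose shifts lie strictly between the reflection of `a` and `a`. -/
def band (a : DigitSeq M) : Set (DigitSeq M) :=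
  {x | ∀ n, LexLT (shift n x) a ∧ LexLT (reflSeq (shift n x)) a}

theorem band_shift (h : x ∈ band a) (n : ℕ) : shift n x ∈ band a := fun p => by
  rw [shift_shift]; exact h _

theorem band_reflSeq (h : x ∈ band a) : reflSeq x ∈ band a := fun p => by
  rw [shift_reflSeq, reflSeq_reflSeq]; exact (h p).symm

theorem band_mono (h : LexLT a b) : band a ⊆ band b := fun _ hx n =>
  ⟨(hx n).1.trans h, (hx n).2.trans h⟩

end LexLemmas

/-! ### Values of expansions and the lexicographic description of unique expansions. -/

section Values

variable {M : ℕ} {q : ℝ} {a b c x y : DigitSeq M}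

theorem summable_expansion (hq : 1 < q) (x : DigitSeq M) :
    Summable fun i : ℕ => ((x i : ℕ) : ℝ) / q ^ (i + 1) := by
  have h0 : (0 : ℝ) < q := by linarith
  have hg : Summable fun i : ℕ => (M : ℝ) * (1 / q) * (1 / q) ^ i :=
    (summable_geometric_of_lt_one (by positivity) ((div_lt_one h0).2 hq)).mul_left _
  refine Summable.of_nonneg_of_le (fun i => by positivity) (fun i => ?_) hg
  have hx : ((x i : ℕ) : ℝ) ≤ M := by exact_mod_cast Nat.le_of_lt_succ (x i).2
  calc ((x i : ℕ) : ℝ) / q ^ (i + 1) ≤ M / q ^ (i + 1) := by gcongr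
    _ = (M : ℝ) * (1 / q) * (1 / q) ^ i := by
      rw [one_div_pow, pow_succ]; field_simp

theorem expansionValue_nonneg (hq : 1 < q) (x : DigitSeq M) : 0 ≤ expansionValue q x :=
  tsum_nonneg fun i => by have : (0 : ℝ) < q := by linarith
                          positivity

theorem expansionValue_step (hq : 1 < q) (x : DigitSeq M) :
    q * expansionValue q x = (x 0 : ℕ) + expansionValue q (shift 1 x) := by
  have h0 : q ≠ 0 := by linarith
  unfold expansionValue
  rw [(summable_expansion hq x).tsum_eq_zero_add, mul_add, ← tsum_mul_left]
  congr 1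
  · rw [zero_add, pow_one]; field_simp
  · congr 1
    funext i
    rw [shift_apply, add_comm 1 i, pow_succ _ (i + 1)]
    field_simp

theorem expansionValue_sub (hq : 1 < q) {n : ℕ} (h : ∀ i < n, x i = y i) :
    q ^ n * (expansionValue q x - expansionValue q y) =
      expansionValue q (shift n x) - expansionValue q (shift n y) := by
  induction n with
  | zero => simp
  | succ n ih =>
    have h1 := expansionValue_step hq (shift n x)
    have h2 := expansionValue_step hq (shift n y)
    rw [shift_shift] at h1 h2
    have h3 : shift n x 0 = shift n y 0 := h n (by omega)
    rw [h3] at h1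
    rw [pow_succ, mul_right_comm, ih fun i hi => h i (by omega)]
    linarith

theorem expansionValue_sub_first (hq : 1 < q) {n : ℕ} (h : ∀ i < n, x i = y i) :
    q ^ (n + 1) * (expansionValue q x - expansionValue q y) =
      ((x n : ℕ) : ℝ) - (y n : ℕ) +
        (expansionValue q (shift (n + 1) x) - expansionValue q (shift (n + 1) y)) := by
  have h1 := expansionValue_step hq (shift n x)
  have h2 := expansionValue_step hq (shift n y)
  rw [shift_shift] at h1 h2
  rw [pow_succ, mul_right_comm, expansionValue_sub hq h]
  simp only [shift_apply, add_zero] at h1 h2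
  linarith

theorem expansionValue_const_zero (q : ℝ) : expansionValue q (fun _ => (0 : Fin (M + 1))) = 0 := by
  simp [expansionValue]

/-- The discrepancy is multiplied by q at each step, yet stays bounded because the remainders do; so
it vanishes. -/
theorem expansionValue_eq_of_recursion (hq : 1 < q) {r : ℕ → ℝ} {B : ℝ}
    (h0 : ∀ n, 0 ≤ r n) (hB : ∀ n, r n ≤ B) (hr : ∀ n, q * r n = (x n : ℕ) + r (n + 1)) :
    expansionValue q x = r 0 := by
  have hq0 : (0 : ℝ) < q := by linarith
  have key : ∀ n, q ^ n * (expansionValue q x - r 0) = expansionValue q (shift n x) - r n := by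
    intro n
    induction n with
    | zero => simp
    | succ n ih =>
      have h1 := expansionValue_step hq (shift n x)
      rw [shift_shift] at h1
      simp only [shift_apply, add_zero] at h1
      rw [pow_succ, mul_right_comm, ih]
      linarith [hr n]
  have hbound : ∀ x : DigitSeq M, expansionValue q x ≤
      ∑' i : ℕ, ((Fin.last M : ℕ) : ℝ) / q ^ (i + 1) := by
    intro x
    refine (summable_expansion hq x).tsum_le_tsum (fun i => ?_)
      (summable_expansion (M := M) hq fun _ => Fin.last M)
    have := Fin.le_last (x i)
    gcongr
    exact this
  set K := ∑' i : ℕ, ((Fin.last M : ℕ) : ℝ) / q ^ (i + 1)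
  have hlim : Tendsto (fun n : ℕ => q ^ n * |expansionValue q x - r 0|) atTop atTop ∨
      |expansionValue q x - r 0| = 0 := by
    rcases (abs_nonneg (expansionValue q x - r 0)).eq_or_lt with h | h
    · exact Or.inr h.symm
    · exact Or.inl ((tendsto_pow_atTop_atTop_of_one_lt hq).atTop_mul_const h)
  rcases hlim with h | h
  · obtain ⟨n, hn⟩ := (h.eventually (eventually_gt_atTop (K + B))).exists
    have h1 : q ^ n * |expansionValue q x - r 0| = |expansionValue q (shift n x) - r n| := by
      rw [← key, abs_mul, abs_of_pos (pow_pos hq0 n)]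
    have h2 := hbound (shift n x)
    have h3 := expansionValue_nonneg hq (shift n x)
    have h4 : |expansionValue q (shift n x) - r n| ≤ K + B :=
      abs_le.2 ⟨by linarith [h0 n, hB n], by linarith [h0 n, hB n]⟩
    linarith
  · linarith [abs_eq_zero.1 h]

theorem expansionValue_const_last (hq : 1 < q) :
    expansionValue q (fun _ => Fin.last M) = M / (q - 1) := by
  have h1 := expansionValue_step hq (fun _ => Fin.last M)
  have h2 : shift 1 (fun _ => Fin.last M) = fun _ => Fin.last M := rfl
  rw [h2, Fin.val_last] at h1
  rw [eq_div_iff (by linarith)]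
  linarith

theorem expansionValue_add_reflSeq (hq : 1 < q) (x : DigitSeq M) :
    expansionValue q x + expansionValue q (reflSeq x) = M / (q - 1) := by
  rw [← expansionValue_const_last hq]
  unfold expansionValue
  rw [← (summable_expansion hq x).tsum_add (summable_expansion hq _)]
  congr 1
  funext i
  rw [← add_div, ← Nat.cast_add, reflSeq_apply, Fin.val_rev, Fin.val_last]
  congr 2
  have := (x i).2
  omega

theorem expansionValue_le (hq : 1 < q) (x : DigitSeq M) : expansionValue q x ≤ M / (q - 1) := by
  linarith [expansionValue_add_reflSeq hq x, expansionValue_nonneg hq (reflSeq x)]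

theorem expansionValue_pos (hq : 1 < q) {n : ℕ} (hn : x n ≠ 0) : 0 < expansionValue q x := by
  refine (summable_expansion hq x).tsum_pos (fun i => ?_) n ?_
  · have : (0 : ℝ) < q := by linarith
    positivity
  · have h0 : (0 : ℝ) < q := by linarith
    have : 0 < ((x n : ℕ) : ℝ) := by
      exact_mod_cast Nat.pos_of_ne_zero fun h => hn (Fin.ext h)
    positivity

theorem expansionValue_shift_pos (hq : 1 < q) (ha : ¬ EndsInZeros a) (n : ℕ) :
    0 < expansionValue q (shift n a) := by
  by_contra hc
  refine ha ⟨n, fun i hi => ?_⟩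
  by_contra h
  obtain ⟨t, rfl⟩ := Nat.exists_eq_add_of_le hi
  exact hc (expansionValue_pos hq (x := shift n a) (n := t) h)

/-- Quasi-greedy expansions exist. -/
theorem exists_expansion_not_endsInZeros (hq : 1 < q) (hqM : q ≤ M + 1) {r : ℝ} (h0 : 0 < r)
    (hr : r ≤ M / (q - 1)) : ∃ x : DigitSeq M, expansionValue q x = r ∧ ¬ EndsInZeros x := by
  have hq1 : 0 < q - 1 := by linarith
  have step : ∀ s : {s : ℝ // 0 < s ∧ s ≤ M / (q - 1)}, ∃ (d : Fin (M + 1))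
      (t : {s : ℝ // 0 < s ∧ s ≤ M / (q - 1)}), q * s.1 = (d : ℕ) + t.1 := by
    rintro ⟨s, hs0, hs⟩
    have hqs : 0 < q * s := by positivity
    -- The digit is ⌈qs⌉ - 1, capped at M. Using this instead of the floor keeps every remainder
    -- positive, which rules out a tail of zeros.
    by_cases hM : q * s ≤ M + 1
    · have h1 : 1 ≤ ⌈q * s⌉₊ := Nat.one_le_ceil_iff.2 hqs
      have h2 : ⌈q * s⌉₊ ≤ M + 1 := Nat.ceil_le.2 (by exact_mod_cast hM)
      have h3 : q * s ≤ ⌈q * s⌉₊ := Nat.le_ceil _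
      have h4 : (⌈q * s⌉₊ : ℝ) < q * s + 1 := Nat.ceil_lt_add_one hqs.le
      have h5 : ((⌈q * s⌉₊ - 1 : ℕ) : ℝ) = ⌈q * s⌉₊ - 1 := by push_cast [h1]; ring
      refine ⟨⟨⌈q * s⌉₊ - 1, by omega⟩, ⟨q * s - (⌈q * s⌉₊ - 1 : ℕ), ?_, ?_⟩, by simp⟩
      · rw [h5]; linarith
      · rw [h5, le_div_iff₀ hq1]
        have : q * s - (⌈q * s⌉₊ - 1) ≤ 1 := by linarith
        nlinarith
    · refine ⟨Fin.last M, ⟨q * s - M, by linarith, ?_⟩, by simp⟩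
      rw [le_div_iff₀ hq1] at hs ⊢
      nlinarith
  choose d t hdt using step
  let R : ℕ → {s : ℝ // 0 < s ∧ s ≤ M / (q - 1)} := fun n => t^[n] ⟨r, h0, hr⟩
  have hR : ∀ n, q * (R n).1 = (d (R n) : ℕ) + (R (n + 1)).1 := by
    intro n
    have : R (n + 1) = t (R n) := Function.iterate_succ_apply' t n _
    rw [this]
    exact hdt _
  have hval : ∀ n, expansionValue q (shift n fun i => d (R i)) = (R n).1 := fun n =>
    expansionValue_eq_of_recursion (x := shift n fun i => d (R i)) hq
      (r := fun i => (R (n + i)).1) (fun i => (R (n + i)).2.1.le)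
      (fun i => (R (n + i)).2.2) (fun i => hR (n + i))
  refine ⟨fun i => d (R i), (shift_zero (fun i => d (R i)) ▸ hval 0 :), ?_⟩
  rintro ⟨N, hN⟩
  have h1 : shift N (fun i => d (R i)) = fun _ => 0 := by
    funext i
    exact hN (N + i) (by omega)
  have h2 := hval N
  rw [h1, expansionValue_const_zero] at h2
  exact (R N).2.1.ne h2

theorem exists_expansion (hq : 1 < q) (hqM : q ≤ M + 1) {r : ℝ} (h0 : 0 ≤ r)
    (hr : r ≤ M / (q - 1)) : ∃ x : DigitSeq M, expansionValue q x = r := by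
  rcases h0.eq_or_lt with h | h
  · exact ⟨fun _ => 0, by rw [expansionValue_const_zero, h]⟩
  · obtain ⟨x, hx, -⟩ := exists_expansion_not_endsInZeros hq hqM h hr
    exact ⟨x, hx⟩

theorem digit_add_one_le {u v : Fin (M + 1)} (h : u < v) : ((u : ℕ) : ℝ) + 1 ≤ (v : ℕ) := by
  exact_mod_cast h

/-- At the first difference the tail of `c` loses at least 1 in its digit, so its excess over 1 is
at most the excess of a later tail divided by q. Iterating sends the bound M/(q-1)/q^t on the excess
to 0. -/
theorem expansionValue_le_one (hq : 1 < q) (ha : expansionValue q a = 1)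
    (hc : ∀ n, LexLE (shift n c) a) (n : ℕ) : expansionValue q (shift n c) ≤ 1 := by
  have hq0 : (0 : ℝ) < q := by linarith
  have hB : (0 : ℝ) ≤ M / (q - 1) := div_nonneg (Nat.cast_nonneg _) (by linarith)
  have key : ∀ t n, expansionValue q (shift n c) ≤ 1 + M / (q - 1) / q ^ t := by
    intro t
    induction t with
    | zero => intro n; simpa using (expansionValue_le hq (shift n c)).trans (by linarith)
    | succ t ih =>
      intro n
      have hD : 0 ≤ (M : ℝ) / (q - 1) / q ^ t := by positivity
      have hD' : (M : ℝ) / (q - 1) / q ^ (t + 1) = (M : ℝ) / (q - 1) / q ^ t / q := by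
        rw [pow_succ]; field_simp
      rcases (lexLE_iff _ _).1 (hc n) with h | h
      · obtain ⟨j, h1, h2⟩ := h.exists_first
        have h3 := expansionValue_sub_first hq h1
        have h4 := digit_add_one_le h2
        have h5 := ih (n + (j + 1))
        have h6 := expansionValue_nonneg hq (shift (j + 1) a)
        rw [shift_shift, ha] at h3
        have h7 : q ^ (j + 1) * (expansionValue q (shift n c) - 1) ≤ M / (q - 1) / q ^ t := by
          linarith
        rw [hD']
        by_contra hcon
        have h8 : M / (q - 1) / q ^ t / q < expansionValue q (shift n c) - 1 := by linarith
        have h9 : M / (q - 1) / q ^ t < (expansionValue q (shift n c) - 1) * q :=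
          (div_lt_iff₀ hq0).1 h8
        have h10 : q ≤ q ^ (j + 1) := le_self_pow₀ hq.le (by omega)
        have h11 : 0 ≤ expansionValue q (shift n c) - 1 := by
          have : 0 ≤ M / (q - 1) / q ^ t / q := by positivity
          linarith
        nlinarith
      · rw [h, ha]
        have : 0 ≤ (M : ℝ) / (q - 1) / q ^ (t + 1) := by positivity
        linarith
  have hlim : Tendsto (fun t : ℕ => 1 + (M : ℝ) / (q - 1) / q ^ t) atTop (𝓝 (1 + 0)) :=
    tendsto_const_nhds.add
      (tendsto_const_nhds.div_atTop (tendsto_pow_atTop_atTop_of_one_lt hq))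
  rw [add_zero] at hlim
  exact ge_of_tendsto' hlim fun t => key t n

theorem expansionValue_lt_one (hq : 1 < q) (ha : expansionValue q a = 1) (ha' : ¬ EndsInZeros a)
    (hc : ∀ n, LexLT (shift n c) a) (n : ℕ) : expansionValue q (shift n c) < 1 := by
  obtain ⟨j, h1, h2⟩ := (hc n).exists_first
  have h3 := expansionValue_sub_first hq h1
  have h4 := digit_add_one_le h2
  have h5 := expansionValue_le_one hq ha (fun n => (hc n).le) (n + (j + 1))
  have h6 := expansionValue_shift_pos hq ha' (j + 1)
  rw [shift_shift, ha] at h3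
  have hq0 : (0 : ℝ) < q ^ (j + 1) := pow_pos (by linarith) _
  by_contra hcon
  have : 0 ≤ q ^ (j + 1) * (expansionValue q (shift n c) - 1) :=
    mul_nonneg hq0.le (by linarith)
  linarith

theorem one_le_expansionValue (hq : 1 < q) (ha : expansionValue q a = 1)
    (ha' : ∀ j, a j < Fin.last M → expansionValue q (shift (j + 1) a) ≤ 1) (h : LexLE a y) :
    1 ≤ expansionValue q y := by
  rcases (lexLE_iff _ _).1 h with h | h
  · obtain ⟨j, h1, h2⟩ := h.exists_first
    have h3 := expansionValue_sub_first hq h1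
    have h4 := digit_add_one_le h2
    have h5 := ha' j (h2.trans_le (Fin.le_last _))
    have h6 := expansionValue_nonneg hq (shift (j + 1) y)
    rw [ha] at h3
    have hq0 : (0 : ℝ) < q ^ (j + 1) := pow_pos (by linarith) _
    by_contra hcon
    have : 0 < q ^ (j + 1) * (1 - expansionValue q y) := mul_pos hq0 (by linarith)
    linarith
  · rw [← h, ha]

/-- Raise the digit at place `n` by one and continue with `e`. -/
theorem exists_raise (hq : 1 < q) {n : ℕ} (hn : x n < Fin.last M) {e : DigitSeq M}
    (he : expansionValue q e = expansionValue q (shift (n + 1) x) - 1) :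
    ∃ b : DigitSeq M, expansionValue q b = expansionValue q x ∧ LexLT x b ∧
      shift (n + 1) b = e := by
  have hn' : (x n : ℕ) + 1 < M + 1 := by
    have : (x n : ℕ) < M := hn
    omega
  let u : DigitSeq M := fun i => if i = n then ⟨x n + 1, hn'⟩ else x i
  have hu : ∀ i < n, cat (n + 1) u e i = x i := fun i hi => by
    rw [cat_of_lt (by omega)]; simp [u, hi.ne]
  have hun : cat (n + 1) u e n = ⟨x n + 1, hn'⟩ := by rw [cat_of_lt (by omega)]; simp [u]
  refine ⟨cat (n + 1) u e, ?_, lexLT_of n (fun i hi => (hu i hi).symm) ?_, shift_cat _⟩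
  · have h3 := expansionValue_sub_first hq hu
    rw [shift_cat, he, hun] at h3
    push_cast at h3
    have hq0 : (0 : ℝ) < q ^ (n + 1) := pow_pos (by linarith) _
    have : q ^ (n + 1) * (expansionValue q (cat (n + 1) u e) - expansionValue q x) = 0 := by
      rw [h3]; ring
    rcases mul_eq_zero.1 this with h | h
    · exact absurd h hq0.ne'
    · linarith
  · rw [hun]
    exact Fin.lt_def.2 (Nat.lt_succ_self _)

/-- If the tail were worth more than 1, one could raise the digit and expand the positive rest
without ending in zeros, contradicting maximality. -/
theorem IsQuasiGreedy.value_shift_le_of_lt (hq : 1 < q) (hqM : q ≤ M + 1) (h : IsQuasiGreedy q a)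
    (n : ℕ) (hn : a n < Fin.last M) : expansionValue q (shift (n + 1) a) ≤ 1 := by
  by_contra hc
  push Not at hc
  obtain ⟨e, he, hez⟩ := exists_expansion_not_endsInZeros (M := M)
    (r := expansionValue q (shift (n + 1) a) - 1) hq hqM (by linarith)
    (by linarith [expansionValue_le hq (shift (n + 1) a)])
  obtain ⟨b, hb, hab, hbe⟩ := exists_raise hq hn he
  refine LexLT.irrefl _ (hab.trans_le (h.2 b (hb.trans h.1.1) ?_))
  rintro ⟨N, hN⟩
  refine hez ⟨N, fun i hi => ?_⟩
  rw [← hbe]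
  exact hN _ (by omega)

theorem IsQuasiGreedy.value_shift_le (hq : 1 < q) (hqM : q ≤ M + 1) (h : IsQuasiGreedy q a)
    (n : ℕ) : expansionValue q (shift n a) ≤ 1 := by
  induction n with
  | zero => rw [shift_zero, h.1.1]
  | succ n ih =>
    rcases (Fin.le_last (a n)).lt_or_eq with hn | hn
    · exact h.value_shift_le_of_lt hq hqM n hn
    -- After a digit M a value s ≤ 1 becomes qs - M ≤ q - M ≤ 1.
    · have h1 := expansionValue_step hq (shift n a)
      rw [shift_shift] at h1
      simp only [shift_apply, add_zero, hn, Fin.val_last] at h1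
      nlinarith

theorem IsQuasiGreedy.shift_le (hq : 1 < q) (hqM : q ≤ M + 1) (h : IsQuasiGreedy q a)
    (n : ℕ) : LexLE (shift n a) a := by
  rw [← not_lexLT]
  intro hlt
  obtain ⟨j, h1, h2⟩ := hlt.exists_first
  have h3 := expansionValue_sub_first hq h1
  have h4 := digit_add_one_le h2
  have h5 := h.value_shift_le hq hqM (j + 1)
  have h6 := expansionValue_shift_pos hq h.1.2 (n + (j + 1))
  have h7 := h.value_shift_le hq hqM n
  rw [shift_shift, h.1.1] at h3
  have hq0 : (0 : ℝ) < q ^ (j + 1) := pow_pos (by linarith) _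
  have : 0 ≤ q ^ (j + 1) * (1 - expansionValue q (shift n a)) :=
    mul_nonneg hq0.le (by linarith)
  linarith

theorem mem_symbolicUnivoqueSet : x ∈ symbolicUnivoqueSet M q ↔
    ∀ y, expansionValue q y = expansionValue q x → y = x := by
  constructor
  · rintro ⟨z, -, hz⟩ y hy
    rw [hz y hy, hz x rfl]
  · exact fun h => ⟨x, rfl, h⟩

theorem univoque_reflSeq (hq : 1 < q) (h : x ∈ symbolicUnivoqueSet M q) :
    reflSeq x ∈ symbolicUnivoqueSet M q := by
  rw [mem_symbolicUnivoqueSet] at h ⊢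
  intro y hy
  have h1 := expansionValue_add_reflSeq hq x
  have h2 := expansionValue_add_reflSeq hq y
  rw [← h (reflSeq y) (by linarith), reflSeq_reflSeq]

theorem univoque_shift_one (hq : 1 < q) (h : x ∈ symbolicUnivoqueSet M q) :
    shift 1 x ∈ symbolicUnivoqueSet M q := by
  rw [mem_symbolicUnivoqueSet] at h ⊢
  intro y hy
  have h1 : ∀ i < 1, cat 1 x y i = x i := fun i hi => cat_of_lt hi
  have h2 := expansionValue_sub hq h1
  rw [shift_cat, hy, sub_self, pow_one] at h2
  have h3 : expansionValue q (cat 1 x y) = expansionValue q x := by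
    rcases mul_eq_zero.1 h2 with h | h <;> linarith
  rw [← h _ h3, shift_cat]

theorem univoque_shift (hq : 1 < q) (h : x ∈ symbolicUnivoqueSet M q) (n : ℕ) :
    shift n x ∈ symbolicUnivoqueSet M q := by
  induction n with
  | zero => simpa using h
  | succ n ih => simpa [shift_shift] using univoque_shift_one hq ih

/-- A tail worth at least 1 would allow raising the digit and so produce a second expansion. -/
theorem univoque_value_shift_lt (hq : 1 < q) (hqM : q ≤ M + 1) (h : x ∈ symbolicUnivoqueSet M q)
    {n : ℕ} (hn : x n < Fin.last M) : expansionValue q (shift (n + 1) x) < 1 := by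
  by_contra hc
  push Not at hc
  obtain ⟨e, he⟩ := exists_expansion (M := M)
    (r := expansionValue q (shift (n + 1) x) - 1) hq hqM (by linarith)
    (by linarith [expansionValue_le hq (shift (n + 1) x)])
  obtain ⟨b, hb, hab, -⟩ := exists_raise hq hn he
  rw [mem_symbolicUnivoqueSet.1 h b hb] at hab
  exact LexLT.irrefl _ hab

theorem univoque_shift_lt (hq : 1 < q) (hqM : q ≤ M + 1) (ha : expansionValue q a = 1)
    (ha' : ∀ j, a j < Fin.last M → expansionValue q (shift (j + 1) a) ≤ 1)
    (h : x ∈ symbolicUnivoqueSet M q) {n : ℕ} (hn : x n < Fin.last M) :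
    LexLT (shift (n + 1) x) a := by
  rw [← not_lexLE]
  intro hle
  exact absurd (one_le_expansionValue hq ha ha' hle)
    (not_le.2 (univoque_value_shift_lt hq hqM h hn))

theorem univoque_reflSeq_shift_lt (hq : 1 < q) (hqM : q ≤ M + 1) (ha : expansionValue q a = 1)
    (ha' : ∀ j, a j < Fin.last M → expansionValue q (shift (j + 1) a) ≤ 1)
    (h : x ∈ symbolicUnivoqueSet M q) {n : ℕ} (hn : 0 < x n) :
    LexLT (reflSeq (shift (n + 1) x)) a := by
  refine univoque_shift_lt hq hqM ha ha' (univoque_reflSeq hq h) (n := n) ?_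
  rw [reflSeq_apply, Fin.lt_def, Fin.val_rev, Fin.val_last]
  have : 0 < (x n : ℕ) := hn
  omega

/-- A larger expansion of the same value needs a tail of `x` worth at least 1, but tails in the band
are worth less. Smaller expansions are excluded by reflection. -/
theorem band_subset_univoque (hq : 1 < q) (ha : expansionValue q a = 1) (ha' : ¬ EndsInZeros a) :
    band a ⊆ symbolicUnivoqueSet M q := by
  have key : ∀ x ∈ band a, ∀ y, expansionValue q y = expansionValue q x → ¬ LexLT x y := by
    intro x hx y hy hlt
    obtain ⟨j, h1, h2⟩ := hlt.exists_first
    have h3 := expansionValue_sub_first hq h1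
    have h4 := digit_add_one_le h2
    have h5 := expansionValue_lt_one hq ha ha' (fun n => (hx n).1) (j + 1)
    have h6 := expansionValue_nonneg hq (shift (j + 1) y)
    rw [hy, sub_self, mul_zero] at h3
    linarith
  intro x hx
  rw [mem_symbolicUnivoqueSet]
  intro y hy
  refine LexLE.antisymm (not_lexLT.1 (key x hx y hy)) ?_
  rw [← lexLE_reflSeq, ← not_lexLT]
  have h1 := expansionValue_add_reflSeq hq x
  have h2 := expansionValue_add_reflSeq hq y
  exact key _ (band_reflSeq hx) _ (by linarith)

end Values

/-! ### Counting prefixes and exponential growth rates. -/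

section Counting

variable {M : ℕ}

/-- The sequence `x` with every digit from place `n` on replaced by `0`. -/
def truncate (n : ℕ) (x : DigitSeq M) : DigitSeq M := cat n x fun _ => 0

theorem truncate_eq_iff {n : ℕ} {x y : DigitSeq M} :
    truncate n x = truncate n y ↔ ∀ i < n, x i = y i := by
  constructor
  · intro h i hi
    have := congrFun h i
    rwa [truncate, truncate, cat_of_lt hi, cat_of_lt hi] at this
  · intro h
    funext i
    simp only [truncate, cat]
    split_ifs with hi
    · exact h i hi
    · rfl

/-- The number of length `n` prefixes of sequences from `X`. -/
noncomputable def prefixCount (X : Set (DigitSeq M)) (n : ℕ) : ℕ := (truncate n '' X).ncard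

theorem finite_truncate_image (X : Set (DigitSeq M)) (n : ℕ) : (truncate n '' X).Finite := by
  let g : (Fin n → Fin (M + 1)) → DigitSeq M := fun u i => if h : i < n then u ⟨i, h⟩ else 0
  refine (Set.finite_range g).subset ?_
  rintro _ ⟨x, -, rfl⟩
  refine ⟨fun i => x i, ?_⟩
  funext i
  simp only [g, truncate, cat]
  split_ifs <;> rfl

theorem prefixCount_eq (X : Set (DigitSeq M)) (n : ℕ) :
    (prefixes X n).ncard = prefixCount X n := by
  have h : prefixes X n = (fun x (i : Fin n) => x i) '' (truncate n '' X) := by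
    rw [Set.image_image]
    refine Set.image_congr fun x _ => ?_
    funext i
    exact (cat_of_lt i.2).symm
  rw [h, prefixCount, Set.InjOn.ncard_image]
  rintro _ ⟨x, -, rfl⟩ _ ⟨y, -, rfl⟩ hxy
  rw [truncate_eq_iff]
  intro i hi
  have := congrFun hxy ⟨i, hi⟩
  simpa [truncate, cat_of_lt hi] using this

theorem prefixCount_pos {X : Set (DigitSeq M)} (hX : X.Nonempty) (n : ℕ) : 0 < prefixCount X n :=
  (Set.ncard_pos (finite_truncate_image X n)).2 (hX.image _)

/-- Counting by a map `g` between prefixes. -/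
theorem prefixCount_le_of_map {X Y : Set (DigitSeq M)} {n m : ℕ}
    (h : ∃ g : DigitSeq M → DigitSeq M, ∀ x ∈ X, ∃ y ∈ Y, truncate n x = g (truncate m y)) :
    prefixCount X n ≤ prefixCount Y m := by
  obtain ⟨g, hg⟩ := h
  refine (Set.ncard_le_ncard ?_ ((finite_truncate_image Y m).image g)).trans
    (Set.ncard_image_le (finite_truncate_image Y m))
  rintro _ ⟨x, hx, rfl⟩
  obtain ⟨y, hy, hxy⟩ := hg x hx
  exact ⟨_, ⟨y, hy, rfl⟩, hxy.symm⟩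

theorem prefixCount_le_of_agree {X Y : Set (DigitSeq M)} {n : ℕ}
    (h : ∀ x ∈ X, ∃ y ∈ Y, ∀ i < n, x i = y i) : prefixCount X n ≤ prefixCount Y n := by
  refine prefixCount_le_of_map ⟨id, fun x hx => ?_⟩
  obtain ⟨y, hy, hxy⟩ := h x hx
  exact ⟨y, hy, truncate_eq_iff.2 hxy⟩

theorem prefixCount_mono {X Y : Set (DigitSeq M)} (h : X ⊆ Y) (n : ℕ) :
    prefixCount X n ≤ prefixCount Y n :=
  prefixCount_le_of_agree fun x hx => ⟨x, h hx, fun _ _ => rfl⟩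

theorem prefixCount_mono_right (X : Set (DigitSeq M)) {n m : ℕ} (h : n ≤ m) :
    prefixCount X n ≤ prefixCount X m := by
  refine prefixCount_le_of_map ⟨truncate n, fun x hx => ⟨x, hx, truncate_eq_iff.2 fun i hi => ?_⟩⟩
  rw [truncate, cat_of_lt (by omega)]

theorem prefixCount_union (X Y : Set (DigitSeq M)) (n : ℕ) :
    prefixCount (X ∪ Y) n ≤ prefixCount X n + prefixCount Y n := by
  rw [prefixCount, Set.image_union]
  exact Set.ncard_union_le _ _

theorem prefixCount_empty (n : ℕ) : prefixCount (∅ : Set (DigitSeq M)) n = 0 := by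
  simp [prefixCount]

theorem prefixCount_iUnion {ι : Type*} (s : Finset ι) (X : ι → Set (DigitSeq M)) (n : ℕ) :
    prefixCount (⋃ i ∈ s, X i) n ≤ ∑ i ∈ s, prefixCount (X i) n := by
  classical
  induction s using Finset.induction_on with
  | empty => simp [prefixCount_empty]
  | insert i s hi ih =>
    rw [Finset.sum_insert hi, Finset.set_biUnion_insert]
    exact (prefixCount_union _ _ _).trans (by omega)

theorem prefixCount_le_one {X : Set (DigitSeq M)} {n : ℕ} {y : DigitSeq M}
    (h : ∀ x ∈ X, ∀ i < n, x i = y i) : prefixCount X n ≤ 1 := by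
  refine (prefixCount_le_of_agree (Y := {y}) fun x hx => ⟨y, rfl, h x hx⟩).trans ?_
  rw [prefixCount, Set.image_singleton, Set.ncard_singleton]

theorem prefixCount_add_le {X Y : Set (DigitSeq M)} {n : ℕ} (h : ∀ x ∈ X, shift n x ∈ Y) (l : ℕ) :
    prefixCount X (n + l) ≤ prefixCount X n * prefixCount Y l := by
  rw [prefixCount, prefixCount, prefixCount, ← Set.ncard_prod]
  refine Set.ncard_le_ncard_of_injOn (fun x => (truncate n x, truncate l (shift n x))) ?_ ?_
    ((finite_truncate_image X n).prod (finite_truncate_image Y l))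
  · rintro _ ⟨x, hx, rfl⟩
    refine ⟨⟨x, hx, truncate_eq_iff.2 fun i hi => ?_⟩,
      ⟨_, h x hx, truncate_eq_iff.2 fun i hi => ?_⟩⟩
    · rw [truncate, cat_of_lt (by omega)]
    · rw [shift_apply, shift_apply, truncate, cat_of_lt (by omega)]
  · rintro _ ⟨x, hx, rfl⟩ _ ⟨y, hy, rfl⟩ hxy
    simp only [Prod.mk.injEq, truncate_eq_iff] at hxy
    refine truncate_eq_iff.2 fun i hi => ?_
    have h0 : ∀ z : DigitSeq M, truncate (n + l) z i = z i := fun z => cat_of_lt hi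
    rw [← h0 x, ← h0 y]
    rcases lt_or_ge i n with hn | hn
    · exact hxy.1 i hn
    · obtain ⟨t, rfl⟩ := Nat.exists_eq_add_of_le hn
      exact hxy.2 t (by omega)

theorem growthRate_eq (X : Set (DigitSeq M)) (n : ℕ) :
    growthRate X n = Real.log (prefixCount X n) / n := by
  rw [growthRate, prefixCount_eq]

theorem subadditive_log_prefixCount {X : Set (DigitSeq M)} (hX : X.Nonempty)
    (h : ∀ x ∈ X, ∀ n, shift n x ∈ X) : Subadditive fun n => Real.log (prefixCount X n) := by
  intro m n
  have h1 : (0 : ℝ) < prefixCount X m := by exact_mod_cast prefixCount_pos hX m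
  have h2 : (0 : ℝ) < prefixCount X n := by exact_mod_cast prefixCount_pos hX n
  have h3 : (0 : ℝ) < prefixCount X (m + n) := by exact_mod_cast prefixCount_pos hX (m + n)
  rw [← Real.log_mul h1.ne' h2.ne']
  refine Real.log_le_log h3 ?_
  exact_mod_cast prefixCount_add_le (fun x hx => h x hx m) n

theorem exists_tendsto_growthRate {X : Set (DigitSeq M)} (hX : X.Nonempty)
    (h : ∀ x ∈ X, ∀ n, shift n x ∈ X) : EntropyExists X := by
  refine ⟨_, ((subadditive_log_prefixCount hX h).tendsto_lim ⟨0, ?_⟩).congr fun n =>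
    (growthRate_eq X n).symm⟩
  rintro _ ⟨n, rfl⟩
  have : (1 : ℝ) ≤ prefixCount X n := by exact_mod_cast prefixCount_pos hX n
  exact div_nonneg (Real.log_nonneg this) (Nat.cast_nonneg _)

/-- `f` grows at exponential rate at most `h`. -/
def GrowsAtMost (f : ℕ → ℝ) (h : ℝ) : Prop :=
  ∀ ε > 0, ∃ C, 0 ≤ C ∧ ∀ n : ℕ, f n ≤ C * Real.exp ((h + ε) * n)

namespace GrowsAtMost

variable {f g : ℕ → ℝ} {h : ℝ}

theorem mono (hf : GrowsAtMost f h) (hgf : ∀ n, g n ≤ f n) : GrowsAtMost g h := fun ε hε => by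
  obtain ⟨C, hC, hf⟩ := hf ε hε
  exact ⟨C, hC, fun n => (hgf n).trans (hf n)⟩

theorem add (hf : GrowsAtMost f h) (hg : GrowsAtMost g h) :
    GrowsAtMost (fun n => f n + g n) h := fun ε hε => by
  obtain ⟨C, hC, hf⟩ := hf ε hε
  obtain ⟨D, hD, hg⟩ := hg ε hε
  exact ⟨C + D, add_nonneg hC hD, fun n => by rw [add_mul]; exact add_le_add (hf n) (hg n)⟩

theorem const_mul (hf : GrowsAtMost f h) {c : ℝ} (hc : 0 ≤ c) :
    GrowsAtMost (fun n => c * f n) h := fun ε hε => by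
  obtain ⟨C, hC, hf⟩ := hf ε hε
  exact ⟨c * C, mul_nonneg hc hC, fun n => by
    rw [mul_assoc]; exact mul_le_mul_of_nonneg_left (hf n) hc⟩

theorem of_exp {l : ℝ} (hl : l ≤ h) : GrowsAtMost (fun n => Real.exp (l * n)) h := fun ε hε =>
  ⟨1, zero_le_one, fun n => by
    rw [one_mul]
    exact Real.exp_le_exp.2 (mul_le_mul_of_nonneg_right (by linarith) (Nat.cast_nonneg _))⟩

theorem const (hh : 0 ≤ h) {c : ℝ} (hc : 0 ≤ c) : GrowsAtMost (fun _ => c) h :=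
  ((of_exp hh).const_mul hc).mono fun n => by simp

theorem conv (hf : GrowsAtMost f h) (hg : GrowsAtMost g h) (hg0 : ∀ n, 0 ≤ g n) :
    GrowsAtMost (fun n => ∑ i ∈ Finset.range (n + 1), f i * g (n - i)) h := fun ε hε => by
  obtain ⟨C, hC, hf⟩ := hf (ε / 2) (by linarith)
  obtain ⟨D, hD, hg⟩ := hg (ε / 2) (by linarith)
  -- Half of ε is spent on the two factors; the other half absorbs the n + 1 summands, at the cost
  -- of 2/ε + 1.
  refine ⟨C * D * (2 / ε + 1), by positivity, fun n => ?_⟩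
  have h1 : ∀ i ∈ Finset.range (n + 1), f i * g (n - i) ≤ C * D * Real.exp ((h + ε / 2) * n) := by
    intro i hi
    have hin : i ≤ n := Nat.lt_succ_iff.1 (Finset.mem_range.1 hi)
    have h2 : Real.exp ((h + ε / 2) * n) =
        Real.exp ((h + ε / 2) * i) * Real.exp ((h + ε / 2) * (n - i : ℕ)) := by
      rw [← Real.exp_add, Nat.cast_sub hin]
      congr 1; ring
    calc f i * g (n - i) ≤ (C * Real.exp ((h + ε / 2) * i)) * g (n - i) :=
          mul_le_mul_of_nonneg_right (hf i) (hg0 _)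
      _ ≤ (C * Real.exp ((h + ε / 2) * i)) * (D * Real.exp ((h + ε / 2) * (n - i : ℕ))) :=
          mul_le_mul_of_nonneg_left (hg _) (by positivity)
      _ = _ := by rw [h2]; ring
  have h3 : ((n : ℝ) + 1) ≤ (2 / ε + 1) * Real.exp (ε / 2 * n) := by
    have h4 : ε / 2 * n + 1 ≤ Real.exp (ε / 2 * n) := Real.add_one_le_exp _
    have h5 : (1 : ℝ) ≤ Real.exp (ε / 2 * n) := Real.one_le_exp (by positivity)
    have h6 : (n : ℝ) = 2 / ε * (ε / 2 * n) := by field_simp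
    have h7 : 2 / ε * (ε / 2 * n) ≤ 2 / ε * Real.exp (ε / 2 * n) := by
      gcongr
      linarith
    linarith
  calc ∑ i ∈ Finset.range (n + 1), f i * g (n - i)
      ≤ ∑ _i ∈ Finset.range (n + 1), C * D * Real.exp ((h + ε / 2) * n) := Finset.sum_le_sum h1
    _ = C * D * Real.exp ((h + ε / 2) * n) * (n + 1) := by
      rw [Finset.sum_const, Finset.card_range, nsmul_eq_mul]; push_cast; ring
    _ ≤ C * D * Real.exp ((h + ε / 2) * n) * ((2 / ε + 1) * Real.exp (ε / 2 * n)) := by gcongr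
    _ = C * D * (2 / ε + 1) * Real.exp ((h + ε) * n) := by
      have : (h + ε) * n = (h + ε / 2) * n + ε / 2 * n := by ring
      rw [this, Real.exp_add]; ring

theorem sum (hf : GrowsAtMost f h) (hh : 0 ≤ h) :
    GrowsAtMost (fun n => ∑ i ∈ Finset.range (n + 1), f i) h := by
  simpa using hf.conv (const hh zero_le_one) fun _ => zero_le_one

end GrowsAtMost

theorem growsAtMost_prefixCount {X : Set (DigitSeq M)} (hX : X.Nonempty) {h : ℝ}
    (hl : Tendsto (growthRate X) atTop (𝓝 h)) :
    GrowsAtMost (fun n => (prefixCount X n : ℝ)) h := by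
  intro ε hε
  obtain ⟨N, hN⟩ := eventually_atTop.1 (hl.eventually (gt_mem_nhds (show h < h + ε by linarith)))
  -- The 1 serves all n beyond N; the sum of normalised counts serves the finitely many others.
  refine ⟨1 + ∑ i ∈ Finset.range (N + 1), prefixCount X i * Real.exp (-((h + ε) * i)),
    by positivity, fun n => ?_⟩
  have hpos : (0 : ℝ) < prefixCount X n := by exact_mod_cast prefixCount_pos hX n
  rcases le_or_gt n N with hn | hn
  · have h1 : prefixCount X n * Real.exp (-((h + ε) * n)) ≤
        ∑ i ∈ Finset.range (N + 1), prefixCount X i * Real.exp (-((h + ε) * i)) :=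
      Finset.single_le_sum (f := fun i : ℕ => prefixCount X i * Real.exp (-((h + ε) * i)))
        (fun i _ => by positivity) (Finset.mem_range.2 (by omega))
    calc (prefixCount X n : ℝ)
        = prefixCount X n * Real.exp (-((h + ε) * n)) * Real.exp ((h + ε) * n) := by
          rw [mul_assoc, ← Real.exp_add]; simp
      _ ≤ _ := by gcongr; linarith
  · have h1 := hN n hn.le
    rw [growthRate_eq, div_lt_iff₀ (by exact_mod_cast (show 0 < n by omega))] at h1
    have h2 : (prefixCount X n : ℝ) ≤ 1 * Real.exp ((h + ε) * n) := by
      rw [one_mul, ← Real.exp_log hpos]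
      exact Real.exp_le_exp.2 h1.le
    refine h2.trans ?_
    gcongr
    exact le_add_of_nonneg_right (Finset.sum_nonneg fun i _ => by positivity)

theorem le_of_growsAtMost_exp {l h : ℝ} (hg : GrowsAtMost (fun n => Real.exp (l * n)) h) :
    l ≤ h := by
  by_contra hc
  push Not at hc
  obtain ⟨C, hC, hg⟩ := hg ((l - h) / 2) (by linarith)
  have h1 : ∀ n : ℕ, Real.exp ((l - h) / 2 * n) ≤ C := by
    intro n
    have h2 : Real.exp (l * n) ≤ _ := hg n
    have h3 : l * n = (l - h) / 2 * n + (h + (l - h) / 2) * n := by ring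
    rw [h3, Real.exp_add] at h2
    exact le_of_mul_le_mul_right h2 (Real.exp_pos _)
  obtain ⟨n, hn⟩ := exists_nat_gt (C / ((l - h) / 2))
  rw [div_lt_iff₀ (by linarith)] at hn
  linarith [h1 n, Real.add_one_le_exp ((l - h) / 2 * n)]

theorem le_of_growsAtMost_prefixCount {X : Set (DigitSeq M)} (hX : X.Nonempty) {h h' : ℝ}
    (hl : Tendsto (growthRate X) atTop (𝓝 h'))
    (hg : GrowsAtMost (fun n => (prefixCount X n : ℝ)) h) : h' ≤ h := by
  refine le_of_forall_pos_le_add fun ε hε => ?_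
  obtain ⟨C, hC, hg⟩ := hg ε hε
  have hlim : Tendsto (fun n : ℕ => Real.log (C + 1) / n + (h + ε)) atTop (𝓝 (0 + (h + ε))) :=
    (tendsto_const_nhds.div_atTop tendsto_natCast_atTop_atTop).add tendsto_const_nhds
  rw [zero_add] at hlim
  refine le_of_tendsto_of_tendsto hl hlim ?_
  filter_upwards [eventually_gt_atTop 0] with n hn
  have hpos : (0 : ℝ) < prefixCount X n := by exact_mod_cast prefixCount_pos hX n
  have hn' : (0 : ℝ) < n := by exact_mod_cast hn
  rw [growthRate_eq, div_add' _ _ _ hn'.ne']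
  gcongr
  have h1 : (prefixCount X n : ℝ) ≤ (C + 1) * Real.exp ((h + ε) * n) :=
    (hg n).trans (by gcongr; linarith)
  calc Real.log (prefixCount X n) ≤ Real.log ((C + 1) * Real.exp ((h + ε) * n)) :=
        Real.log_le_log hpos h1
    _ = Real.log (C + 1) + (h + ε) * n := by
      rw [Real.log_mul (by positivity) (Real.exp_pos _).ne', Real.log_exp]

end Counting

/-! ### From the univoque conditions to the band. -/

section UnivoqueToBand

variable {M : ℕ} {a x : DigitSeq M}

/-- The univoque condition says nothing after a digit M. But then `a` begins with M too, and
cancelling this common letter leaves a tail below `shift 1 a`, hence below `a`. -/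
theorem shift_succ_lt (hsh : ∀ n, LexLE (shift n a) a)
    (hx : ∀ n, x n < Fin.last M → LexLT (shift (n + 1) x) a) {n : ℕ} (hn : LexLT (shift n x) a) :
    LexLT (shift (n + 1) x) a := by
  rcases (Fin.le_last (x n)).lt_or_eq with h | h
  · exact hx n h
  · have h0 : x n ≤ a 0 := hn.le.apply_le (n := 0) fun i hi => absurd hi (Nat.not_lt_zero i)
    have h1 : ∀ i < 1, shift n x i = a i := by
      intro i hi
      obtain rfl : i = 0 := by omega
      rw [shift_apply, add_zero]
      exact le_antisymm h0 (h ▸ Fin.le_last _)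
    have h2 := (lexLT_shift_iff h1).2 hn
    rw [shift_shift] at h2
    exact h2.trans_le (hsh 1)

theorem shift_lt_of_digit_lt (hsh : ∀ n, LexLE (shift n a) a)
    (hx : ∀ n, x n < Fin.last M → LexLT (shift (n + 1) x) a) {i n : ℕ} (hi : x i < Fin.last M)
    (hn : i < n) : LexLT (shift n x) a := by
  induction n, hn using Nat.le_induction with
  | base => exact hx i hi
  | succ n _ ih => exact shift_succ_lt hsh hx ih

theorem shift_mem_band (hsh : ∀ n, LexLE (shift n a) a)
    (hx : ∀ n, x n < Fin.last M → LexLT (shift (n + 1) x) a)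
    (hx' : ∀ n, 0 < x n → LexLT (reflSeq (shift (n + 1) x)) a) {r : ℕ}
    (h1 : ∃ i ≤ r, x i < Fin.last M) (h2 : ∃ i ≤ r, 0 < x i) : shift (r + 1) x ∈ band a := by
  obtain ⟨i, hir, hi⟩ := h1
  obtain ⟨j, hjr, hj⟩ := h2
  intro n
  rw [shift_shift]
  refine ⟨shift_lt_of_digit_lt hsh hx hi (by omega),
    shift_lt_of_digit_lt (x := reflSeq x) hsh (fun p hp => hx' p ?_) (i := j) ?_ (by omega)⟩
  · rw [reflSeq_apply, Fin.lt_def, Fin.val_rev, Fin.val_last] at hp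
    rw [Fin.lt_def, Fin.val_zero]
    omega
  · rw [reflSeq_apply, Fin.lt_def, Fin.val_rev, Fin.val_last]
    rw [Fin.lt_def, Fin.val_zero] at hj
    omega

/-- A sequence obeying the univoque conditions is, up to an initial run of `0` or `M` and one more
digit, a member of the band. -/
theorem exists_band_tail (hsh : ∀ n, LexLE (shift n a) a)
    (hx : ∀ n, x n < Fin.last M → LexLT (shift (n + 1) x) a)
    (hx' : ∀ n, 0 < x n → LexLT (reflSeq (shift (n + 1) x)) a) (N : ℕ) :
    ((∀ i < N, x i = 0) ∨ ∀ i < N, x i = Fin.last M) ∨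
      ∃ r < N, ((∀ i < r, x i = 0) ∨ ∀ i < r, x i = Fin.last M) ∧ shift (r + 1) x ∈ band a := by
  classical
  by_cases hP : ∃ r, r < N ∧ (∃ i ≤ r, x i < Fin.last M) ∧ ∃ i ≤ r, 0 < x i
  · refine Or.inr ⟨Nat.find hP, (Nat.find_spec hP).1, ?_,
      shift_mem_band hsh hx hx' (Nat.find_spec hP).2.1 (Nat.find_spec hP).2.2⟩
    set r := Nat.find hP with hr
    by_contra hc
    push Not at hc
    obtain ⟨⟨i, hi, hi0⟩, j, hj, hj0⟩ := hc
    refine Nat.find_min hP (m := r - 1) (by omega) ⟨?_, ⟨j, by omega, ?_⟩, ⟨i, by omega, ?_⟩⟩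
    · have := (Nat.find_spec hP).1
      omega
    · exact lt_of_le_of_ne (Fin.le_last _) hj0
    · exact Fin.pos_of_ne_zero hi0
  · left
    by_contra hc
    push Not at hc
    obtain ⟨⟨i, hi, hi0⟩, j, hj, hj0⟩ := hc
    exact hP ⟨N - 1, by omega, ⟨j, by omega, lt_of_le_of_ne (Fin.le_last _) hj0⟩,
      ⟨i, by omega, Fin.pos_of_ne_zero hi0⟩⟩

theorem growsAtMost_of_band {X : Set (DigitSeq M)} (hsh : ∀ n, LexLE (shift n a) a)
    (hX : ∀ x ∈ X, (∀ n, x n < Fin.last M → LexLT (shift (n + 1) x) a) ∧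
      ∀ n, 0 < x n → LexLT (reflSeq (shift (n + 1) x)) a)
    {h : ℝ} (hh : 0 ≤ h) (hb : GrowsAtMost (fun n => (prefixCount (band a) n : ℝ)) h) :
    GrowsAtMost (fun n => (prefixCount X n : ℝ)) h := by
  set K := prefixCount (Set.univ : Set (DigitSeq M)) 1
  let C : ℕ → Set (DigitSeq M) := fun n => {x | ∀ i < n, x i = 0} ∪ {x | ∀ i < n, x i = Fin.last M}
  have hC : ∀ n, prefixCount (C n) n ≤ 2 := fun n =>
    (prefixCount_union _ _ _).trans (Nat.add_le_add
      (prefixCount_le_one (y := fun _ => 0) fun x hx => hx)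
      (prefixCount_le_one (y := fun _ => Fin.last M) fun x hx => hx))
  -- Sorted by run length r: two runs, at most K values of the next digit, then a band sequence.
  let Y : ℕ → Set (DigitSeq M) := fun r => {x | x ∈ C r ∧ shift (r + 1) x ∈ band a}
  have hY : ∀ N, ∀ r ∈ Finset.range N, prefixCount (Y r) N ≤
      2 * K * prefixCount (band a) (N - (r + 1)) := by
    intro N r hr
    obtain ⟨l, rfl⟩ := Nat.exists_eq_add_of_le (Finset.mem_range.1 hr)
    refine (prefixCount_add_le (fun x hx => hx.2) l).trans ?_
    rw [Nat.add_sub_cancel_left]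
    refine Nat.mul_le_mul_right _ ?_
    refine (prefixCount_add_le (Y := Set.univ) (fun x _ => Set.mem_univ _) 1).trans ?_
    exact Nat.mul_le_mul_right _ ((prefixCount_mono (fun x hx => hx.1) r).trans (hC r))
  have hle : ∀ N, (prefixCount X N : ℝ) ≤ 2 + ∑ i ∈ Finset.range (N + 1),
      (2 * K : ℝ) * prefixCount (band a) (N - i) := by
    intro N
    have h1 : X ⊆ C N ∪ ⋃ r ∈ Finset.range N, Y r := by
      intro x hx
      rcases exists_band_tail hsh (hX x hx).1 (hX x hx).2 N with h | ⟨r, hr, h1, h2⟩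
      · exact Or.inl h
      · refine Or.inr ?_
        simp only [Set.mem_iUnion, Finset.mem_range]
        exact ⟨r, hr, h1, h2⟩
    have h2 : prefixCount X N ≤ 2 + ∑ r ∈ Finset.range N,
        2 * K * prefixCount (band a) (N - (r + 1)) :=
      ((prefixCount_mono h1 N).trans (prefixCount_union _ _ _)).trans (Nat.add_le_add (hC N)
        ((prefixCount_iUnion _ _ _).trans (Finset.sum_le_sum (hY N))))
    have h3 : 2 + ∑ r ∈ Finset.range N, 2 * K * prefixCount (band a) (N - (r + 1)) ≤
        2 + ∑ i ∈ Finset.range (N + 1), 2 * K * prefixCount (band a) (N - i) := by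
      rw [Finset.sum_range_succ' _ N]
      omega
    exact_mod_cast h2.trans h3
  exact ((GrowsAtMost.const hh zero_le_two).add ((GrowsAtMost.const hh
    (by positivity : (0 : ℝ) ≤ 2 * K)).conv hb fun n => Nat.cast_nonneg _)).mono hle

end UnivoqueToBand

/-! ### Overlaps of a sequence with its reflection, and lowered periodic sequences. -/

section Overlaps

variable {M : ℕ} {a c x : DigitSeq M} {m : ℕ}

theorem periodic_lexLT_first {x y : DigitSeq M} (hm : 0 < m) (hx : shift m x = x)
    (hy : shift m y = y) (h : LexLT x y) : ∃ j < m, (∀ i < j, x i = y i) ∧ x j < y j := by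
  obtain ⟨j, h1, h2⟩ := h.exists_first
  refine ⟨j, ?_, h1, h2⟩
  by_contra hj
  obtain ⟨t, rfl⟩ := Nat.exists_eq_add_of_le (not_lt.1 hj)
  have e1 : x (m + t) = x t := congrFun hx t
  have e2 : y (m + t) = y t := congrFun hy t
  rw [e1, e2, h1 t (by omega)] at h2
  exact lt_irrefl _ h2

theorem periodic_eq_of_agree {x y : DigitSeq M} (hm : 0 < m) (hx : shift m x = x)
    (hy : shift m y = y) (h : ∀ i < m, x i = y i) : x = y := by
  refine LexLE.antisymm (not_lexLT.1 fun hl => ?_) (not_lexLT.1 fun hl => ?_)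
  · obtain ⟨j, hj, -, h2⟩ := periodic_lexLT_first hm hy hx hl
    exact h2.ne' (h j hj)
  · obtain ⟨j, hj, -, h2⟩ := periodic_lexLT_first hm hx hy hl
    exact h2.ne (h j hj)

theorem shift_shift_comm (hper : shift m a = a) (i : ℕ) : shift m (shift i a) = shift i a := by
  rw [shift_shift, add_comm, ← shift_shift, hper]

/-- If a suffix of `x_i' … x_(i-1)` matches the reflection of `a` and so does `x_i … x_(J-1)`, then
so does all of `x_i' … x_(J-1)`. -/
theorem overlap_extend (hsh : ∀ n, LexLE (shift n a) a) {i' i J : ℕ} (hi : i' < i)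
    (hx : LexLE (reflSeq a) (shift i' x))
    (h1 : ∀ t, i' + t < i → x (i' + t) = (a t).rev) (h2 : ∀ t, i + t < J → x (i + t) = (a t).rev) :
    ∀ t, i' + t < J → x (i' + t) = (a t).rev := by
  intro t
  induction t using Nat.strong_induction_on with
  | _ t ih =>
    intro htJ
    rcases lt_or_ge (i' + t) i with h | h
    · exact h1 t h
    obtain ⟨d, rfl⟩ := Nat.exists_eq_add_of_lt hi
    obtain ⟨p, rfl⟩ : ∃ p, t = d + 1 + p := ⟨t - (d + 1), by omega⟩
    have hagree : ∀ s < p, a s = shift (d + 1) a s := by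
      intro s hs
      have e1 := ih (d + 1 + s) (by omega) (by omega)
      have e2 := h2 s (by omega)
      rw [show i' + d + 1 + s = i' + (d + 1 + s) by ring, e1, Fin.rev_inj] at e2
      exact e2.symm
    have e2 := h2 p (by omega)
    rw [show i' + d + 1 + p = i' + (d + 1 + p) by ring] at e2
    have h3 : (a (d + 1 + p)).rev ≤ x (i' + (d + 1 + p)) :=
      hx.apply_le (n := d + 1 + p) fun s hs => (ih s hs (by omega)).symm
    rw [e2] at h3 ⊢
    rw [Fin.rev_le_rev] at h3
    have h4 : a (d + 1 + p) ≤ a p :=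
      (hsh (d + 1)).apply_le (n := p) fun s hs => (hagree s hs).symm
    rw [le_antisymm h3 h4]

/-- No proper nonempty suffix of `a_0 … a_k` is the reflection of a prefix of `a`. -/
def OverlapFree (a : DigitSeq M) (k : ℕ) : Prop :=
  ∀ i, i ≤ k → ¬ ∀ t, i + t < k + 1 → a (i + t) = (a t).rev

/-- Take the prefix of length N + m + 1 and cut it just before its earliest overlap. An overlap of
the shorter word would merge with the removed one (`overlap_extend`) and start earlier. The cut is
not before N, as an overlap of m letters makes a whole shift equal to the reflection. -/
theorem exists_overlapFree (hm : 0 < m) (hper : shift m a = a) (hadm : a ∈ admissibleSeqs M)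
    (hne : ∀ i, shift i a ≠ reflSeq a) (N : ℕ) : ∃ k, N ≤ k ∧ OverlapFree a k := by
  classical
  by_cases hfree : OverlapFree a (N + m)
  · exact ⟨N + m, by omega, hfree⟩
  have hex : ∃ i, i ≤ N + m ∧ ∀ t, i + t < N + m + 1 → a (i + t) = (a t).rev := by
    simpa [OverlapFree] using hfree
  obtain ⟨h1, h2⟩ := Nat.find_spec hex
  have hmin : ∀ i' < Nat.find hex, ¬ _ := fun i' hi' => Nat.find_min hex hi'
  set i := Nat.find hex with hi
  have hiN : N + 1 < i ∨ N + 1 = i := by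
    by_contra hc
    refine hne i (periodic_eq_of_agree hm (shift_shift_comm hper i) ?_ fun t ht => h2 t (by omega))
    rw [shift_reflSeq, hper]
  refine ⟨i - 1, by omega, fun i' hi' hov => hmin i' (by omega) ⟨by omega, ?_⟩⟩
  exact overlap_extend (fun n => (hadm n).2) (by omega) (hadm i').1
    (fun t ht => hov t (by omega)) h2

theorem rep_shift {k : ℕ} (w : Word M k) : shift (k + 1) (rep w) = rep w := by
  funext i
  simp [rep]

theorem rep_apply {k : ℕ} (w : Word M k) {i : ℕ} (hi : i < k + 1) : rep w i = w ⟨i, hi⟩ := by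
  simp only [rep]
  congr 2
  exact Nat.mod_eq_of_lt hi

theorem shift_mod {k : ℕ} (hc : shift (k + 1) c = c) (n : ℕ) :
    shift n c = shift (n % (k + 1)) c := by
  induction n using Nat.strong_induction_on with
  | _ n ih =>
    rcases lt_or_ge n (k + 1) with h | h
    · rw [Nat.mod_eq_of_lt h]
    · obtain ⟨t, rfl⟩ := Nat.exists_eq_add_of_le h
      rw [← shift_shift, hc, ih t (by omega), Nat.add_mod_left]

/-- The periodic sequence `(a_0 … a_k⁻)^∞`. -/
def lowered (a : DigitSeq M) (k : ℕ) : DigitSeq M := rep (minus (initial a k))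

theorem lowered_shift (a : DigitSeq M) (k : ℕ) : shift (k + 1) (lowered a k) = lowered a k :=
  rep_shift _

theorem lowered_of_lt {k i : ℕ} (hi : i < k) : lowered a k i = a i := by
  rw [lowered, rep_apply _ (by omega), minus, Function.update_of_ne, initial]
  simp [Fin.ext_iff, hi.ne]

theorem lowered_self {k : ℕ} (hk : 0 < a k) : (lowered a k k : ℕ) + 1 = a k := by
  have h1 : lowered a k k = a k - 1 := by
    rw [lowered, rep_apply _ (by omega), minus]
    exact Function.update_self ..
  have h2 : 0 < (a k : ℕ) := hk
  have h3 := (a k).2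
  have hM : (1 : Fin (M + 1)).val = 1 := by
    obtain ⟨M, rfl⟩ : ∃ M', M = M' + 1 := ⟨M - 1, by omega⟩
    rfl
  rw [h1, Fin.sub_val_of_le (by rw [Fin.le_def, hM]; omega), hM]
  omega

theorem lowered_lt {k : ℕ} (hk : 0 < a k) : lowered a k k < a k := by
  have := lowered_self hk
  rw [Fin.lt_def]
  omega

theorem lowered_le {k i : ℕ} (hk : 0 < a k) (hi : i ≤ k) : lowered a k i ≤ a i := by
  rcases hi.lt_or_eq with h | rfl
  · rw [lowered_of_lt h]
  · exact (lowered_lt hk).le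

/-- Either the suffix of the word copies a prefix of `a`, and the decreased last digit makes it
smaller, or its first deviation is already downward. The sequence `v` is free beyond its first k
letters so that both `a` and `lowered a k` are allowed. -/
theorem shift_lowered_lt (hsh : ∀ n, LexLE (shift n a) a) {k n : ℕ} (hk : 0 < a k) (hn : 0 < n)
    (hnk : n ≤ k) {v : DigitSeq M} (hv : ∀ t < k, v t = a t) : LexLT (shift n (lowered a k)) v := by
  classical
  by_cases hag : ∀ t, n + t ≤ k → a (n + t) = a t
  · refine lexLT_of (k - n) (fun i hi => ?_) ?_
    · rw [shift_apply, lowered_of_lt (by omega), hag i (by omega), hv i (by omega)]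
    · rw [shift_apply, show n + (k - n) = k by omega, hv _ (by omega), ← hag (k - n) (by omega),
        show n + (k - n) = k by omega]
      exact lowered_lt hk
  · push Not at hag
    have hs := Nat.find_spec hag
    have hmin : ∀ i < Nat.find hag, ¬ _ := fun i hi => Nat.find_min hag hi
    set t := Nat.find hag
    have hag' : ∀ i < t, a (n + i) = a i := fun i hi => by
      by_contra hc
      exact hmin i hi ⟨by omega, hc⟩
    refine lexLT_of t (fun i hi => ?_) ?_
    · rw [shift_apply, lowered_of_lt (by omega), hag' i hi, hv i (by omega)]
    · rw [shift_apply, hv t (by omega)]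
      exact (lowered_le hk hs.1).trans_lt (lt_of_le_of_ne ((hsh n).apply_le hag') hs.2)

/-- Without overlaps the suffix exceeds the reflected prefix at some letter. Lowering destroys this
only if that letter is the last one and the gap is exactly 1, and then the lowered suffix equals the
reflected prefix. -/
theorem lt_shift_lowered_or (hadm : a ∈ admissibleSeqs M) {k n : ℕ} (hfree : OverlapFree a k)
    (hk : 0 < a k) (hn : 0 < n) (hnk : n ≤ k) :
    (∀ v : DigitSeq M, (∀ t < k, v t = a t) → LexLT (reflSeq v) (shift n (lowered a k))) ∨
      ∀ t, n + t < k + 1 → lowered a k (n + t) = (a t).rev := by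
  classical
  have hov := hfree n hnk
  push Not at hov
  have hs := Nat.find_spec hov
  have hmin : ∀ i < Nat.find hov, ¬ _ := fun i hi => Nat.find_min hov hi
  set t := Nat.find hov
  have hag : ∀ i < t, a (n + i) = (a i).rev := fun i hi => by
    by_contra hc
    exact hmin i hi ⟨by omega, hc⟩
  have hgt : (a t).rev < a (n + t) :=
    lt_of_le_of_ne ((hadm n).1.apply_le (n := t) fun i hi => (hag i hi).symm) (Ne.symm hs.2)
  have hlow : ∀ i < t, lowered a k (n + i) = (a i).rev := fun i hi => by
    rw [lowered_of_lt (by omega), hag i hi]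
  have hge : (a t).rev ≤ lowered a k (n + t) := by
    rcases (show n + t ≤ k by omega).lt_or_eq with h | h
    · rw [lowered_of_lt h]; exact hgt.le
    · rw [h] at hgt ⊢
      have := lowered_self hk
      rw [Fin.lt_def] at hgt
      rw [Fin.le_def]
      omega
  rcases hge.lt_or_eq with h | h
  · refine Or.inl fun v hv => lexLT_of t (fun i hi => ?_) ?_
    · rw [reflSeq_apply, hv i (by omega), shift_apply, hlow i hi]
    · rwa [reflSeq_apply, hv t (by omega), shift_apply]
  · refine Or.inr fun i hi => ?_
    have htk : n + t = k := by
      by_contra hc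
      rw [lowered_of_lt (by omega)] at h
      exact hgt.ne h
    rcases (show i ≤ t by omega).lt_or_eq with h' | rfl
    · exact hlow i h'
    · exact h.symm

/-- An admissible periodic sequence none of whose shifts is its reflection is approximated from
below inside its band. -/
theorem exists_mem_band_agree (hm : 0 < m) (hper : shift m a = a) (hadm : a ∈ admissibleSeqs M)
    (h0 : (a 0).rev < a 0) (hne : ∀ i, shift i a ≠ reflSeq a) :
    ∃ c ∈ band a, ∀ i < m, c i = a i := by
  obtain ⟨k, hmk, hfree⟩ := exists_overlapFree hm hper hadm hne m
  have hk : 0 < a k := by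
    -- A zero last digit would be the reflection of the first digit, an overlap of length one.
    have h1 := hfree k le_rfl
    refine Fin.pos_of_ne_zero fun hz => h1 fun t ht => ?_
    obtain rfl : t = 0 := by omega
    have h2 : (a 0).rev ≤ a k :=
      (hadm k).1.apply_le (n := 0) fun i hi => absurd hi (Nat.not_lt_zero i)
    rw [add_zero]
    refine le_antisymm ?_ h2
    rw [hz]
    exact Fin.zero_le _
  have hagree : ∀ i < m, lowered a k i = a i := fun i hi => lowered_of_lt (by omega)
  refine ⟨lowered a k, fun n => ?_, hagree⟩
  rw [shift_mod (lowered_shift a k) n]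
  have hlt : n % (k + 1) < k + 1 := Nat.mod_lt _ (by omega)
  set r := n % (k + 1)
  rcases Nat.eq_zero_or_pos r with hr | hr
  · rw [hr, shift_zero]
    refine ⟨lexLT_of k (fun i hi => lowered_of_lt hi) (lowered_lt hk),
      lexLT_of 0 (fun i hi => absurd hi (Nat.not_lt_zero i)) ?_⟩
    rwa [reflSeq_apply, hagree 0 hm]
  · refine ⟨shift_lowered_lt (fun n => (hadm n).2) hk hr (by omega) fun _ _ => rfl, ?_⟩
    rw [lexLT_reflSeq_left]
    rcases lt_shift_lowered_or hadm hfree hk hr (by omega) with h | h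
    · exact h a fun _ _ => rfl
    · rw [← lexLT_shift_iff (a := reflSeq a) (b := shift r (lowered a k)) (n := k + 1 - r) fun i hi => (h i (by omega)).symm, shift_shift,
        show r + (k + 1 - r) = k + 1 by omega, lowered_shift, shift_reflSeq]
      -- In the remaining case the period restarts after the matched suffix. Strictness comes from
      -- `hne`, and periodicity puts the first difference within m letters, where `lowered a k`
      -- still agrees with `a`.
      have h1 : LexLT (reflSeq (shift (k + 1 - r) a)) a := by
        rcases (lexLE_iff _ _).1 (lexLE_reflSeq_left.1 (hadm (k + 1 - r)).1) with h | h
        · exact h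
        · exact absurd (by rw [← reflSeq_reflSeq (shift _ a), h]) (hne (k + 1 - r))
      obtain ⟨j, hj, h2, h3⟩ := periodic_lexLT_first hm
        (by rw [shift_reflSeq, shift_shift_comm hper]) hper h1
      exact lexLT_of j (fun i hi => (h2 i hi).trans (hagree i (by omega)).symm)
        (by rwa [hagree j hj])

theorem lowered_mem_admissibleSeqs (hadm : a ∈ admissibleSeqs M) {k : ℕ} (hfree : OverlapFree a k)
    (hk : 0 < a k) (h0 : (lowered a k 0).rev ≤ lowered a k 0)
    (h0' : 0 < k → (a 0).rev < a 0) : lowered a k ∈ admissibleSeqs M := by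
  have key : ∀ p n, 0 < n → n ≤ k → (∀ i < p, (lowered a k i).rev = lowered a k (n + i)) →
      (lowered a k p).rev ≤ lowered a k (n + p) := by
    intro p
    induction p using Nat.strong_induction_on with
    | _ p ih =>
      intro n hn hnk hag
      rcases lt_shift_lowered_or hadm hfree hk hn hnk with h | h
      · exact (h _ fun t ht => lowered_of_lt ht).le.apply_le hag
      · rcases lt_or_ge (n + p) (k + 1) with hp | hp
        · rw [h p hp, lowered_of_lt (by omega)]
        -- Past the end of the period, reflecting the inequality turns it into the same claim with n
        -- replaced by k + 1 - n and p by the smaller p'.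
        · obtain ⟨p', rfl⟩ : ∃ p', p = k + 1 - n + p' := ⟨p - (k + 1 - n), by omega⟩
          have hsh : ∀ i, lowered a k (n + (k + 1 - n + i)) = lowered a k i := fun i => by
            rw [show n + (k + 1 - n + i) = k + 1 + i by omega]
            exact congrFun (lowered_shift a k) i
          rw [hsh, ← Fin.rev_le_rev, Fin.rev_rev]
          refine ih p' (by omega) (k + 1 - n) (by omega) (by omega) fun i hi => ?_
          rw [← hsh i, ← hag _ (by omega), Fin.rev_rev]
  intro n
  rw [shift_mod (lowered_shift a k) n]
  have hlt : n % (k + 1) < k + 1 := Nat.mod_lt _ (by omega)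
  set r := n % (k + 1)
  rcases Nat.eq_zero_or_pos r with hr | hr
  · rw [hr, shift_zero]
    refine ⟨?_, LexLE.refl _⟩
    rcases h0.lt_or_eq with h | h
    · exact (lexLT_of 0 (fun i hi => absurd hi (Nat.not_lt_zero i)) h).le
    · have hk0 : k = 0 := by
        by_contra hk0
        rw [lowered_of_lt (by omega)] at h
        exact (h0' (by omega)).ne h
      subst hk0
      have hconst : ∀ i, lowered a 0 i = lowered a 0 0 := fun i => by
        have := congrFun (shift_mod (lowered_shift a 0) i) 0
        simpa [Nat.mod_one] using this
      refine lexLE_of_forall fun i _ => ?_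
      rw [reflSeq_apply, hconst i]
      exact h0
  · exact ⟨lexLE_of_forall fun p hp => key p r hr (by omega) hp,
      (shift_lowered_lt (fun n => (hadm n).2) hk hr (by omega) fun t ht => lowered_of_lt ht).le⟩

theorem plus_last_val {k : ℕ} {w : Word M k} (hw : w (Fin.last k) < Fin.last M) :
    (plus w (Fin.last k) : ℕ) = w (Fin.last k) + 1 := by
  rw [plus, Function.update_self, Fin.val_add_one_of_lt hw]

/-- At the smallest shift k + 1 equal to the reflection, the prefix of length k + 1 is free of
overlaps, so its lowered repetition is admissible. Irreducibility then makes the tail of `a` exceed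
the repeated raised reflection of that prefix. But this tail begins with the unraised reflection and
is smaller. `hbase` covers k = 0, where lowering the first digit could push it below M/2. -/
theorem shift_ne_reflSeq_of_isIrreducibleSeq (hirr : IsIrreducibleSeq a) (h0 : (a 0).rev < a 0)
    (hbase : 2 * (a 0 : ℕ) = M + 1 → shift 1 a ≠ reflSeq a) (i : ℕ) : shift i a ≠ reflSeq a := by
  classical
  intro hi
  have hex : ∃ i, shift i a = reflSeq a := ⟨i, hi⟩
  have hs := Nat.find_spec hex
  have hmin : ∀ i < Nat.find hex, ¬ _ := fun i hi => Nat.find_min hex hi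
  have hadm := hirr.1
  obtain ⟨k, hk⟩ : ∃ k, Nat.find hex = k + 1 := by
    refine Nat.exists_eq_succ_of_ne_zero fun hz => ?_
    rw [hz, shift_zero] at hs
    exact h0.ne (congrFun hs 0).symm
  rw [hk] at hs hmin
  have hfree : OverlapFree a k := by
    intro i hik hov
    rcases Nat.eq_zero_or_pos i with rfl | hi0
    · have := hov 0 (by omega)
      rw [add_zero] at this
      exact h0.ne this.symm
    refine hmin i (by omega) (funext fun t => ?_)
    exact overlap_extend (J := i + t + 1) (i := k + 1) (fun n => (hadm n).2) (by omega)
      (hadm i).1 hov (fun t _ => congrFun hs t) t (by omega)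
  have hkpos : 0 < a k := by
    refine Fin.pos_of_ne_zero fun hz => hfree k le_rfl fun t ht => ?_
    obtain rfl : t = 0 := by omega
    have h2 : (a 0).rev ≤ a k :=
      (hadm k).1.apply_le (n := 0) fun i hi => absurd hi (Nat.not_lt_zero i)
    rw [add_zero]
    refine le_antisymm ?_ h2
    rw [hz]
    exact Fin.zero_le _
  have hlow0 : (lowered a k 0).rev ≤ lowered a k 0 := by
    rcases Nat.eq_zero_or_pos k with rfl | hk0
    · have h1 := lowered_self hkpos
      have h2 : 2 * (a 0 : ℕ) ≠ M + 1 := fun h => hbase h hs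
      rw [Fin.lt_def, Fin.val_rev] at h0
      rw [Fin.le_def, Fin.val_rev]
      omega
    · rw [lowered_of_lt hk0]
      exact h0.le
  have hlt := hirr.2 k hkpos (lowered_mem_admissibleSeqs hadm hfree hkpos hlow0 fun _ => h0)
  have hag : ∀ i < k + 1, append (initial a k) (rep (plus (refl (initial a k)))) i = a i := by
    intro i hi
    simp [append, hi, initial]
  rw [← lexLT_shift_iff hag, hs] at hlt
  have hsh : shift (k + 1) (append (initial a k) (rep (plus (refl (initial a k))))) =
      rep (plus (refl (initial a k))) := by
    funext i
    rw [shift_apply, append, dif_neg (by omega), Nat.add_sub_cancel_left]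
  rw [hsh] at hlt
  refine LexLT.irrefl _ (hlt.trans (lexLT_of k (fun i hi => ?_) ?_))
  · rw [rep_apply _ (by omega), plus, Function.update_of_ne (by simp [Fin.ext_iff, hi.ne])]
    rfl
  · have hl : refl (initial a k) (Fin.last k) < Fin.last M := by
      rw [Fin.lt_def, refl, Fin.val_rev, Fin.val_last]
      have : 0 < (a k : ℕ) := hkpos
      simp only [initial, Fin.val_last]
      omega
    have h1 := plus_last_val hl
    rw [rep_apply _ (by omega), Fin.lt_def]
    change ((a k).rev : ℕ) < (plus (refl (initial a k)) (Fin.last k) : ℕ)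
    rw [h1]
    change ((a k).rev : ℕ) < ((a k).rev : ℕ) + 1
    omega

/-- If the band conditions hold for `x` at all places before `n`, and `σ^n x ≽ a`, then the first
`n` letters of `x` are obtained from a member of the band, possibly followed by the start of the
reflection of `a`. -/
theorem exists_band_prefix (hm : 0 < m) (hper : shift m a = a) (hadm : a ∈ admissibleSeqs M)
    (hc : c ∈ band a) (hca : ∀ i < m, c i = a i) {n : ℕ}
    (hx : ∀ p < n, LexLT (shift p x) a ∧ LexLT (reflSeq (shift p x)) a)
    (hn : LexLE a (shift n x)) :
    (∃ z ∈ band a, ∀ i < n, x i = z i) ∨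
      ∃ n' < n, (∃ z ∈ band a, ∀ i < n', x i = z i) ∧
        ∀ t, n' + t < n → x (n' + t) = (a t).rev := by
  classical
  -- No suffix of the first n letters copies a prefix of `a`: cancelling it would give `shift n x`
  -- below a shift of `a`, against `hn`.
  have hup : ∀ p < n, ¬ ∀ t < n - p, shift p x t = a t := by
    intro p hp hag
    have h1 := (lexLT_shift_iff hag).2 (hx p hp).1
    rw [shift_shift, show p + (n - p) = n by omega] at h1
    exact LexLT.irrefl _ ((h1.trans_le (hadm _).2).trans_le hn)
  by_cases hex : ∃ n', n' < n ∧ ∀ t, n' + t < n → x (n' + t) = (a t).rev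
  · right
    obtain ⟨hn', hov⟩ := Nat.find_spec hex
    have hmin : ∀ i < Nat.find hex, ¬ _ := fun i hi => Nat.find_min hex hi
    set n' := Nat.find hex
    -- Cut at the earliest reflected overlap n' and continue with the reflection of `c`, which
    -- imitates the reflection of `a` for a whole period but stays inside the band.
    refine ⟨n', hn', ⟨cat n' x (reflSeq c), fun p => ?_, fun i hi => (cat_of_lt hi).symm⟩, hov⟩
    rcases le_or_gt n' p with hp | hp
    · rw [shift_cat_of_ge hp]
      exact band_reflSeq hc _
    rw [shift_cat_of_le hp.le]
    constructor
    · by_cases hag : ∀ t < n' - p, shift p x t = a t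
      · rw [← lexLT_shift_iff (n := n' - p) fun t ht => by rw [cat_of_lt ht, hag t ht], shift_cat]
        obtain ⟨s, hs1, hs2⟩ := (hx p (by omega)).1.exists_first
        have hsn : s < n - p := by
          by_contra hc
          exact hup p (by omega) fun t ht => hs1 t (by omega)
        have hsn' : n' - p ≤ s := by
          by_contra hc
          exact hs2.ne (hag s (by omega))
        obtain ⟨j, rfl⟩ := Nat.exists_eq_add_of_le hsn'
        have e : ∀ t, shift p x (n' - p + t) = x (n' + t) := fun t => by
          rw [shift_apply]; congr 1; omega
        -- The tail of `x` drops below `a` only inside the overlap, where `x` copies the reflection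
        -- of `a`. By periodicity the difference occurs within m letters, where `c` and `a` agree.
        have hlt : LexLT (reflSeq a) (shift (n' - p) a) := by
          refine lexLT_of j (fun t ht => ?_) ?_
          · rw [reflSeq_apply, ← hov t (by omega), ← e, hs1 _ (by omega), shift_apply]
          · rw [reflSeq_apply, ← hov j (by omega), ← e]
            exact hs2
        obtain ⟨j, hj, h1, h2⟩ := periodic_lexLT_first hm (by rw [shift_reflSeq, hper])
          (shift_shift_comm hper _) hlt
        refine lexLT_of j (fun t ht => ?_) ?_
        · rw [reflSeq_apply, hca t (by omega)]; exact h1 t ht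
        · rw [reflSeq_apply, hca j hj]; exact h2
      · exact (hx p (by omega)).1.of_agree hag fun t ht => cat_of_lt ht
    · rw [reflSeq_cat]
      refine (hx p (by omega)).2.of_agree (n := n' - p) (fun hag => ?_) fun t ht => cat_of_lt ht
      refine hmin p hp ⟨by omega, ?_⟩
      refine overlap_extend (fun n => (hadm n).2) hp
        (lexLE_reflSeq_left.1 (hx p (by omega)).2.le) (fun t ht => ?_) hov
      rw [← hag t (by omega), reflSeq_apply, Fin.rev_rev, shift_apply]
  · left
    refine ⟨cat n x c, fun p => ?_, fun i hi => (cat_of_lt hi).symm⟩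
    rcases le_or_gt n p with hp | hp
    · rw [shift_cat_of_ge hp]
      exact hc _
    rw [shift_cat_of_le hp.le, reflSeq_cat]
    refine ⟨(hx p hp).1.of_agree (hup p hp) fun t ht => cat_of_lt ht,
      (hx p hp).2.of_agree (n := n - p) (fun hag => hex ⟨p, hp, fun t ht => ?_⟩)
        fun t ht => cat_of_lt ht⟩
    rw [← hag t (by omega), reflSeq_apply, Fin.rev_rev, shift_apply]

end Overlaps

/-! ### Growth of the band at the right endpoint. -/

section UpperBound

variable {M : ℕ} {a a' c x : DigitSeq M} {m : ℕ}

theorem prefixCount_preimage_reflSeq (X : Set (DigitSeq M)) (n : ℕ) :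
    prefixCount {x | reflSeq x ∈ X} n ≤ prefixCount X n := by
  refine prefixCount_le_of_map ⟨fun u => truncate n (reflSeq u),
    fun x hx => ⟨reflSeq x, hx, truncate_eq_iff.2 fun i hi => ?_⟩⟩
  rw [reflSeq_apply, truncate, cat_of_lt hi, reflSeq_apply, Fin.rev_rev]

/-- Members of the band of `a' = w⁺ (refl w)^∞` that are at least `a = w^∞`. -/
def upperBand (a a' : DigitSeq M) : Set (DigitSeq M) := {y | y ∈ band a' ∧ LexLE a y}

variable {k : ℕ}

/-- Lying between `a` and `a'` forces the first block to be w or w⁺. After w the rest is still at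
least `a`; after w⁺ it is below the reflection of `a`, so its reflection is above `a`. -/
theorem upperBand_block (hper : shift (k + 1) a = a) (hag : ∀ i < k, a' i = a i)
    (hk : (a' k : ℕ) = a k + 1) (hsh : shift (k + 1) a' = reflSeq a) {y : DigitSeq M}
    (hy : y ∈ upperBand a a') :
    ((∀ i < k + 1, y i = a i) ∧ shift (k + 1) y ∈ upperBand a a') ∨
      ((∀ i < k + 1, y i = a' i) ∧ reflSeq (shift (k + 1) y) ∈ upperBand a a') := by
  have hlt : LexLT y a' := by simpa using (hy.1 0).1
  have h1 : ∀ i < k, y i = a i := by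
    intro i
    induction i using Nat.strong_induction_on with
    | _ i ih =>
      intro hi
      refine le_antisymm ?_ (hy.2.apply_le fun j hj => (ih j hj (by omega)).symm)
      rw [← hag i hi]
      exact hlt.le.apply_le fun j hj => (ih j hj (by omega)).trans (hag j (by omega)).symm
  have h2 : a k ≤ y k := hy.2.apply_le fun j hj => (h1 j hj).symm
  have h3 : y k ≤ a' k := hlt.le.apply_le fun j hj => (h1 j hj).trans (hag j hj).symm
  have hsplit : ∀ (v : DigitSeq M), (∀ i < k, v i = a i) → y k = v k → ∀ i < k + 1, y i = v i := by
    intro v hv hvk i hi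
    rcases (Nat.lt_succ_iff.1 hi).lt_or_eq with h | rfl
    · rw [h1 i h, hv i h]
    · exact hvk
  by_cases hyk : y k = a k
  · have hya := hsplit a (fun _ _ => rfl) hyk
    refine Or.inl ⟨hya, band_shift hy.1 _, ?_⟩
    have := (lexLE_shift_iff fun i hi => (hya i hi).symm).2 hy.2
    rwa [hper] at this
  · have hya := hsplit a' hag (by
      rw [Fin.le_def] at h2 h3
      refine Fin.ext ?_
      have : (y k : ℕ) ≠ a k := fun h => hyk (Fin.ext h)
      omega)
    refine Or.inr ⟨hya, band_reflSeq (band_shift hy.1 _), ?_⟩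
    have := (lexLT_shift_iff hya).2 hlt
    rw [hsh] at this
    exact (lexLT_reflSeq.1 (by rwa [reflSeq_reflSeq])).le

theorem prefixCount_upperBand (hper : shift (k + 1) a = a) (hag : ∀ i < k, a' i = a i)
    (hk : (a' k : ℕ) = a k + 1) (hsh : shift (k + 1) a' = reflSeq a) (j : ℕ) :
    prefixCount (upperBand a a') ((k + 1) * j) ≤ 2 ^ j := by
  induction j with
  | zero => exact prefixCount_le_one (y := a) fun x _ i hi => absurd hi (by omega)
  | succ j ih =>
    set E := upperBand a a'
    have h1 : E ⊆ {y | (∀ i < k + 1, y i = a i) ∧ shift (k + 1) y ∈ E} ∪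
        {y | (∀ i < k + 1, y i = a' i) ∧ reflSeq (shift (k + 1) y) ∈ E} :=
      fun y hy => upperBand_block hper hag hk hsh hy
    rw [Nat.mul_succ, Nat.add_comm]
    refine ((prefixCount_mono h1 _).trans (prefixCount_union _ _ _)).trans ?_
    rw [pow_succ, mul_two]
    refine Nat.add_le_add ?_ ?_
    · refine (prefixCount_add_le (fun x hx => hx.2) _).trans ?_
      calc _ ≤ 1 * prefixCount E ((k + 1) * j) :=
            Nat.mul_le_mul_right _ (prefixCount_le_one fun x hx => hx.1)
        _ ≤ _ := by rw [one_mul]; exact ih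
    · refine (prefixCount_add_le (Y := {y | reflSeq y ∈ E}) (fun x hx => hx.2) _).trans ?_
      calc _ ≤ 1 * prefixCount E ((k + 1) * j) :=
            Nat.mul_le_mul (prefixCount_le_one fun x hx => hx.1)
              (prefixCount_preimage_reflSeq _ _)
        _ ≤ _ := by rw [one_mul]; exact ih

theorem growsAtMost_upperBand (hper : shift (k + 1) a = a) (hag : ∀ i < k, a' i = a i)
    (hk : (a' k : ℕ) = a k + 1) (hsh : shift (k + 1) a' = reflSeq a) {h : ℝ}
    (hh : Real.log 2 / (k + 1 : ℕ) ≤ h) :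
    GrowsAtMost (fun n => (prefixCount (upperBand a a') n : ℝ)) h := by
  refine ((GrowsAtMost.of_exp hh).const_mul zero_le_two).mono fun n => ?_
  -- Rounding up to whole blocks costs one extra block, hence the factor 2.
  have h1 : n ≤ (k + 1) * (n / (k + 1) + 1) := (Nat.lt_mul_div_succ n (by omega)).le
  have h2 : prefixCount (upperBand a a') n ≤ 2 ^ (n / (k + 1) + 1) :=
    (prefixCount_mono_right _ h1).trans (prefixCount_upperBand hper hag hk hsh _)
  have h3 : (2 : ℝ) ^ (n / (k + 1)) ≤ Real.exp (Real.log 2 / (k + 1 : ℕ) * n) := by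
    rw [← Real.exp_log (show (0 : ℝ) < 2 ^ (n / (k + 1)) by positivity), Real.log_pow]
    refine Real.exp_le_exp.2 ?_
    rw [div_mul_eq_mul_div, mul_comm, mul_div_assoc]
    exact mul_le_mul_of_nonneg_left Nat.cast_div_le (Real.log_nonneg one_le_two)
  calc (prefixCount (upperBand a a') n : ℝ) ≤ (2 : ℝ) ^ (n / (k + 1) + 1) := by exact_mod_cast h2
    _ = 2 * 2 ^ (n / (k + 1)) := by ring
    _ ≤ _ := by gcongr

/-- Sequences whose first `n` letters start like a member of the band of `a` and continue, up to
place `n`, with letters of the reflection of `a`. -/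
def startSet (a : DigitSeq M) (n : ℕ) : Set (DigitSeq M) :=
  {x | ∃ z ∈ band a, ∀ i < n, x i = z i} ∪ ⋃ p ∈ Finset.range n,
    {x | (∃ z ∈ band a, ∀ i < p, x i = z i) ∧ ∀ t, p + t < n → x (p + t) = (a t).rev}

theorem mem_startSet {n : ℕ} : x ∈ startSet a n ↔ (∃ z ∈ band a, ∀ i < n, x i = z i) ∨
    ∃ p < n, (∃ z ∈ band a, ∀ i < p, x i = z i) ∧ ∀ t, p + t < n → x (p + t) = (a t).rev := by
  simp only [startSet, Set.mem_union, Set.mem_iUnion, Finset.mem_range, Set.mem_ofPred_eq,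
    exists_prop]

theorem startSet_anti {n N : ℕ} (h : N ≤ n) : startSet a n ⊆ startSet a N := by
  intro x hx
  rw [mem_startSet] at hx ⊢
  rcases hx with ⟨z, hz, hxz⟩ | ⟨p, hp, ⟨z, hz, hxz⟩, hov⟩
  · exact Or.inl ⟨z, hz, fun i hi => hxz i (by omega)⟩
  · rcases lt_or_ge p N with hpN | hpN
    · exact Or.inr ⟨p, hpN, ⟨z, hz, hxz⟩, fun t ht => hov t (by omega)⟩
    · exact Or.inl ⟨z, hz, fun i hi => hxz i (by omega)⟩

theorem prefixCount_startSet (a : DigitSeq M) (n : ℕ) : prefixCount (startSet a n) n ≤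
    ∑ p ∈ Finset.range (n + 1), prefixCount (band a) p := by
  rw [Finset.sum_range_succ, Nat.add_comm]
  refine (prefixCount_union _ _ _).trans (Nat.add_le_add ?_ ?_)
  · exact prefixCount_le_of_agree fun x hx => hx
  · refine (prefixCount_iUnion _ _ _).trans (Finset.sum_le_sum fun p hp => ?_)
    obtain ⟨l, rfl⟩ := Nat.exists_eq_add_of_le (Finset.mem_range.1 hp).le
    refine (prefixCount_add_le (Y := {y | ∀ t < l, y t = (a t).rev})
      (fun x hx t ht => hx.2 t (by omega)) l).trans ?_
    calc _ ≤ prefixCount (band a) p * 1 := Nat.mul_le_mul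
          (prefixCount_le_of_agree fun x hx => hx.1)
          (prefixCount_le_one (y := reflSeq a) fun x hx => hx)
      _ = _ := mul_one _

/-- The band of `a' = w⁺ (refl w)^∞` grows no faster than that of `a = w^∞`, provided the latter
has entropy at least `log 2 / |w|`. -/
theorem growsAtMost_band_right (hper : shift (k + 1) a = a) (hag : ∀ i < k, a' i = a i)
    (hk : (a' k : ℕ) = a k + 1) (hsh : shift (k + 1) a' = reflSeq a) (hadm : a ∈ admissibleSeqs M)
    (hc : c ∈ band a) (hca : ∀ i < k + 1, c i = a i) {h : ℝ}
    (hh : Real.log 2 / (k + 1 : ℕ) ≤ h)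
    (hb : GrowsAtMost (fun n => (prefixCount (band a) n : ℝ)) h) :
    GrowsAtMost (fun n => (prefixCount (band a') n : ℝ)) h := by
  classical
  have hh0 : 0 ≤ h := (div_nonneg (Real.log_nonneg one_le_two) (Nat.cast_nonneg _)).trans hh
  have hE := growsAtMost_upperBand hper hag hk hsh hh
  set E := upperBand a a'
  let T : ℕ → ℕ := fun n => ∑ p ∈ Finset.range (n + 1), prefixCount (band a) p
  have hT : GrowsAtMost (fun n => (T n : ℝ)) h := by
    refine (hb.sum hh0).mono fun n => ?_
    simp only [T]
    push_cast
    exact le_rfl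
  let Z : ℕ → Set (DigitSeq M) := fun n => {x | x ∈ startSet a n ∧ shift n x ∈ E}
  have hZ : ∀ N, ∀ n ∈ Finset.range (N + 1),
      prefixCount (Z n ∪ {x | reflSeq x ∈ Z n}) N ≤ 2 * (T n * prefixCount E (N - n)) := by
    intro N n hn
    obtain ⟨l, rfl⟩ := Nat.exists_eq_add_of_le (Nat.lt_succ_iff.1 (Finset.mem_range.1 hn))
    have h1 : prefixCount (Z n) (n + l) ≤ T n * prefixCount E l :=
      (prefixCount_add_le (fun x hx => hx.2) l).trans (Nat.mul_le_mul_right _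
        ((prefixCount_mono (fun x hx => hx.1) n).trans (prefixCount_startSet a n)))
    rw [Nat.add_sub_cancel_left, two_mul]
    exact (prefixCount_union _ _ _).trans
      (Nat.add_le_add h1 ((prefixCount_preimage_reflSeq _ _).trans h1))
  -- Sorted by the first place n where the conditions of `band a` fail; if n exceeds N or does not
  -- exist, only the start matters.
  have hcover : ∀ N, band a' ⊆ (startSet a N ∪ {x | reflSeq x ∈ startSet a N}) ∪
      ⋃ n ∈ Finset.range (N + 1), (Z n ∪ {x | reflSeq x ∈ Z n}) := by
    intro N x hx
    by_cases hex : ∃ n, ¬ (LexLT (shift n x) a ∧ LexLT (reflSeq (shift n x)) a)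
    · have hs := Nat.find_spec hex
      have hmin : ∀ i < Nat.find hex, ¬ _ := fun i hi => Nat.find_min hex hi
      set n := Nat.find hex
      have hmin' : ∀ p < n, LexLT (shift p x) a ∧ LexLT (reflSeq (shift p x)) a := fun p hp =>
        not_not.1 (hmin p hp)
      have hcase : (x ∈ startSet a n ∧ LexLE a (shift n x)) ∨
          (reflSeq x ∈ startSet a n ∧ LexLE a (shift n (reflSeq x))) := by
        rw [not_and_or, not_lexLT, not_lexLT] at hs
        rcases hs with hs | hs
        · exact Or.inl ⟨mem_startSet.2
            (exists_band_prefix (Nat.succ_pos k) hper hadm hc hca hmin' hs), hs⟩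
        · refine Or.inr ⟨mem_startSet.2
            (exists_band_prefix (Nat.succ_pos k) hper hadm hc hca (fun p hp => ?_) hs), hs⟩
          rw [shift_reflSeq, reflSeq_reflSeq]
          exact (hmin' p hp).symm
      rcases lt_or_ge N n with hN | hN
      · left
        rcases hcase with h | h
        · exact Or.inl (startSet_anti hN.le h.1)
        · exact Or.inr (startSet_anti hN.le h.1)
      · right
        simp only [Set.mem_iUnion, Finset.mem_range]
        refine ⟨n, by omega, ?_⟩
        rcases hcase with h | h
        · exact Or.inl ⟨h.1, band_shift hx n, h.2⟩
        · exact Or.inr ⟨h.1, band_shift (band_reflSeq hx) n, h.2⟩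
    · push Not at hex
      exact Or.inl (Or.inl (mem_startSet.2 (Or.inl ⟨x, hex, fun _ _ => rfl⟩)))
  have hle : ∀ N, prefixCount (band a') N ≤
      2 * T N + 2 * ∑ n ∈ Finset.range (N + 1), T n * prefixCount E (N - n) := by
    intro N
    refine ((prefixCount_mono (hcover N) N).trans (prefixCount_union _ _ _)).trans
      (Nat.add_le_add ?_ ?_)
    · rw [two_mul]
      exact (prefixCount_union _ _ _).trans (Nat.add_le_add (prefixCount_startSet a N)
        ((prefixCount_preimage_reflSeq _ _).trans (prefixCount_startSet a N)))
    · rw [Finset.mul_sum]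
      exact (prefixCount_iUnion _ _ _).trans (Finset.sum_le_sum (hZ N))
  refine ((hT.const_mul zero_le_two).add
    ((hT.conv hE fun n => Nat.cast_nonneg _).const_mul zero_le_two)).mono fun N => ?_
  exact_mod_cast hle N

end UpperBound

/-! ### First digits beyond the Komornik–Loreti constant. -/

section KomornikLoreti

variable {M : ℕ} {q : ℝ} {a b x : DigitSeq M}

theorem univoqueBases_nonempty (hM : 1 ≤ M) : (univoqueBases M).Nonempty := by
  have hM' : (1 : ℝ) ≤ M := by exact_mod_cast hM
  have hq : (1 : ℝ) < M + 1 := by linarith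
  have hval : expansionValue ((M : ℝ) + 1) (fun _ => Fin.last M) = 1 := by
    rw [expansionValue_const_last hq, add_sub_cancel_right, div_self (by linarith)]
  refine ⟨M + 1, hq, le_rfl, fun _ => Fin.last M, hval, fun y hy => ?_⟩
  have h1 := expansionValue_add_reflSeq hq y
  rw [← expansionValue_const_last hq, hval, hy] at h1
  funext i
  by_contra hi
  have h2 := expansionValue_pos hq (x := reflSeq y) (n := i) fun h => hi (by
    rw [← Fin.rev_rev (y i), ← reflSeq_apply, h, Fin.rev_zero])
  linarith

theorem one_le_qKL (hM : 1 ≤ M) : 1 ≤ qKL M :=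
  le_csInf (univoqueBases_nonempty hM) fun _ hq => hq.1.le

theorem expansionValue_strictAnti {p : ℝ} (hq : 1 < q) (hqp : q < p) (hb : b 0 ≠ 0) :
    expansionValue p b < expansionValue q b := by
  have hq0 : 0 < q := by linarith
  refine Summable.tsum_lt_tsum (i := 0) (fun i => ?_) ?_ (summable_expansion (hq.trans hqp) b)
    (summable_expansion hq b)
  · gcongr
  · have : 0 < ((b 0 : ℕ) : ℝ) := by
      exact_mod_cast Nat.pos_of_ne_zero fun h => hb (Fin.ext h)
    gcongr

/-- A self-dominating sequence that is a lower bound of all unique expansions of `1` represents `1`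
only in bases up to the Komornik–Loreti constant. -/
theorem le_qKL_of_forall_lexLE (hM : 1 ≤ M) {p : ℝ} (hp : expansionValue p b = 1)
    (hb0 : b 0 ≠ 0) (hsh : ∀ n, LexLE (shift n b) b)
    (hle : ∀ x : DigitSeq M, 0 < x 0 → (∀ n, x n < Fin.last M → LexLT (shift (n + 1) x) x) →
      (∀ n, 0 < x n → LexLT (reflSeq (shift (n + 1) x)) x) → LexLE b x) : p ≤ qKL M := by
  refine le_csInf (univoqueBases_nonempty hM) ?_
  rintro q ⟨hq, hqM, x, hx, hux⟩
  have hU : x ∈ symbolicUnivoqueSet M q := by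
    rw [mem_symbolicUnivoqueSet, hx]
    exact hux
  have hval : ∀ j, x j < Fin.last M → expansionValue q (shift (j + 1) x) ≤ 1 := fun j hj =>
    (univoque_value_shift_lt hq hqM hU hj).le
  have hx0 : 0 < x 0 := by
    refine Fin.pos_of_ne_zero fun h0 => ?_
    have h1 := expansionValue_step hq x
    have h2 := univoque_value_shift_lt hq hqM hU (n := 0) (by
      rw [h0, Fin.lt_def]; exact hM)
    rw [h0, hx] at h1
    simp only [Fin.val_zero, Nat.cast_zero, zero_add] at h1 h2
    linarith
  have hbx := hle x hx0 (fun n hn => univoque_shift_lt hq hqM hx hval hU hn)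
    fun n hn => univoque_reflSeq_shift_lt hq hqM hx hval hU hn
  by_contra hc
  have h1 := expansionValue_strictAnti hq (not_le.1 hc) hb0
  have h2 := expansionValue_le_one hq hx (fun n => (hsh n).trans hbx) 0
  rw [shift_zero] at h2
  linarith

theorem half_le_head (hx0 : 0 < x 0) (hU : ∀ n, x n < Fin.last M → LexLT (shift (n + 1) x) x)
    (hL : ∀ n, 0 < x n → LexLT (reflSeq (shift (n + 1) x)) x) : M ≤ 2 * (x 0 : ℕ) := by
  by_contra hc
  have h1 : x 1 ≤ x 0 := (hU 0 (by rw [Fin.lt_def, Fin.val_last]; omega)).le.apply_le (n := 0)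
    fun i hi => absurd hi (Nat.not_lt_zero i)
  have h2 : (x 1).rev ≤ x 0 := (hL 0 hx0).le.apply_le (n := 0)
    fun i hi => absurd hi (Nat.not_lt_zero i)
  rw [Fin.le_def] at h1 h2
  rw [Fin.val_rev] at h2
  omega

/-- K^∞ is a lower bound for unique expansions of 1: after a positive digit the next one is at least
M minus the first digit, so it is at least K as long as the first digit is K. -/
theorem le_qKL_of_even {K : ℕ} (hM : 1 ≤ M) (hK : M = 2 * K) {p : ℝ}
    (hp : expansionValue p b = 1) (hb : ∀ i, (b i : ℕ) = K) : p ≤ qKL M := by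
  refine le_qKL_of_forall_lexLE hM hp (fun h => ?_) (fun n => ?_) fun x hx0 hU hL => ?_
  · have := hb 0
    rw [h, Fin.val_zero] at this
    omega
  · exact lexLE_of_forall fun i _ => by rw [shift_apply, Fin.le_def, hb, hb]
  · refine lexLE_of_forall fun p hag => ?_
    have h0 := half_le_head hx0 hU hL
    rcases Nat.eq_zero_or_pos p with rfl | hp
    · rw [Fin.le_def, hb]; omega
    · obtain ⟨p, rfl⟩ : ∃ r, p = r + 1 := ⟨p - 1, by omega⟩
      have h1 : (x (p + 1)).rev ≤ x 0 := by
        refine (hL p ?_).le.apply_le (n := 0) fun i hi => absurd hi (Nat.not_lt_zero i)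
        rw [← hag p (by omega), Fin.lt_def, hb, Fin.val_zero]
        omega
      rw [← hag 0 (by omega), Fin.le_def, hb, Fin.val_rev] at h1
      rw [Fin.le_def, hb]
      omega

theorem le_qKL_of_odd {K : ℕ} (hM : 1 ≤ M) (hK : M = 2 * K + 1) {p : ℝ}
    (hp : expansionValue p b = 1) (hb : ∀ i, (b i : ℕ) = if i % 2 = 0 then K + 1 else K) :
    p ≤ qKL M := by
  refine le_qKL_of_forall_lexLE hM hp (fun h => ?_) (fun n => ?_) fun x hx0 hU hL => ?_
  · have := hb 0
    rw [h, Fin.val_zero, if_pos rfl] at this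
    omega
  · rcases Nat.even_or_odd n with ⟨r, hr⟩ | ⟨r, hr⟩
    · refine lexLE_of_forall fun i _ => ?_
      rw [shift_apply, Fin.le_def, hb, hb, show (n + i) % 2 = i % 2 by omega]
    · refine (lexLT_of 0 (fun i hi => absurd hi (Nat.not_lt_zero i)) ?_).le
      rw [shift_apply, Fin.lt_def, hb, hb, if_neg (by omega), if_pos rfl]
      omega
  · refine lexLE_of_forall fun p hag => ?_
    have h0 := half_le_head hx0 hU hL
    rw [Fin.le_def, hb]
    rcases Nat.eq_zero_or_pos p with rfl | hp
    · rw [if_pos rfl]; omega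
    obtain ⟨p, rfl⟩ : ∃ r, p = r + 1 := ⟨p - 1, by omega⟩
    have hx0' := hb 0
    rw [hag 0 (by omega), if_pos rfl] at hx0'
    by_cases hpar : p % 2 = 0
    · have hxp := hb p
      rw [hag p (by omega), if_pos hpar] at hxp
      have h1 : (x (p + 1)).rev ≤ x 0 := by
        refine (hL p ?_).le.apply_le (n := 0) fun i hi => absurd hi (Nat.not_lt_zero i)
        rw [Fin.lt_def, hxp, Fin.val_zero]
        omega
      rw [Fin.le_def, hx0', Fin.val_rev] at h1
      rw [if_neg (by omega)]
      omega
    · obtain ⟨p, rfl⟩ : ∃ r, p = r + 1 := ⟨p - 1, by omega⟩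
      have hxp := hb p
      rw [hag p (by omega), if_pos (by omega)] at hxp
      have hxp' := hb (p + 1)
      rw [hag (p + 1) (by omega), if_neg (by omega)] at hxp'
      have hx1 := hb 1
      rw [hag 1 (by omega), if_neg (by omega)] at hx1
      -- After (K+1)K the reflected tail already matches the first digit K+1, so the comparison
      -- moves to the second digit K and forces K+1 next.
      have h1 : (x (p + 1 + 1)).rev ≤ x 1 := by
        refine (hL p ?_).le.apply_le (n := 1) fun i hi => ?_
        · rw [Fin.lt_def, hxp, Fin.val_zero]
          omega
        · obtain rfl : i = 0 := by omega
          refine Fin.ext ?_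
          rw [reflSeq_apply, shift_apply, Fin.val_rev, hx0']
          change M + 1 - ((x (p + 1) : ℕ) + 1) = K + 1
          omega
      rw [Fin.le_def, hx1, Fin.val_rev] at h1
      rw [if_pos (by omega)]
      omega

theorem admissible_le_head (hadm : a ∈ admissibleSeqs M) (n : ℕ) : a n ≤ a 0 :=
  (hadm n).2.apply_le (n := 0) fun i hi => absurd hi (Nat.not_lt_zero i)

theorem admissible_rev_le (hadm : a ∈ admissibleSeqs M) (n : ℕ) : (a 0).rev ≤ a n :=
  (hadm n).1.apply_le (n := 0) fun i hi => absurd hi (Nat.not_lt_zero i)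

/-- The first digit of the quasi-greedy expansion beyond the Komornik–Loreti constant. -/
theorem head_gt_of_qKL_lt (hM : 1 ≤ M) (hadm : a ∈ admissibleSeqs M) (hq : qKL M < q)
    (ha : expansionValue q a = 1) : M < 2 * (a 0 : ℕ) := by
  by_contra hc
  have h0 := admissible_rev_le hadm 0
  rw [Fin.le_def, Fin.val_rev] at h0
  refine absurd (le_qKL_of_even hM (K := a 0) (by omega) ha fun i => ?_) (not_le.2 hq)
  have h1 := admissible_le_head hadm i
  have h2 := admissible_rev_le hadm i
  rw [Fin.le_def] at h1 h2
  rw [Fin.val_rev] at h2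
  omega

/-- Otherwise the second digit is K, and admissibility forces the alternating sequence ((K+1)K)^∞,
whose base is at most `qKL M`. -/
theorem second_of_qKL_lt (hM : 1 ≤ M) (hadm : a ∈ admissibleSeqs M) (hq : qKL M < q)
    (ha : expansionValue q a = 1) (h0 : 2 * (a 0 : ℕ) = M + 1) : a 1 = a 0 := by
  by_contra hc
  have hle := admissible_le_head hadm 1
  have hge := admissible_rev_le hadm 1
  obtain ⟨K, hK⟩ : ∃ K, M = 2 * K + 1 := ⟨a 0 - 1, by omega⟩
  have ha0 : (a 0 : ℕ) = K + 1 := by omega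
  have ha1 : (a 1 : ℕ) = K := by
    rw [Fin.le_def] at hle hge
    rw [Fin.val_rev] at hge
    have : (a 1 : ℕ) ≠ a 0 := fun h => hc (Fin.ext h)
    omega
  refine absurd (le_qKL_of_odd hM hK ha fun i => ?_) (not_le.2 hq)
  induction i with
  | zero => simpa using ha0
  | succ n ih =>
    have h1 := admissible_le_head hadm (n + 1)
    have h2 := admissible_rev_le hadm (n + 1)
    rw [Fin.le_def] at h1 h2
    rw [Fin.val_rev] at h2
    by_cases hpar : n % 2 = 0
    · rw [if_pos hpar] at ih
      rw [if_neg (by omega)]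
      have h3 : a (n + 1) ≤ a 1 := (hadm n).2.apply_le (n := 1) fun i hi => by
        obtain rfl : i = 0 := by omega
        exact Fin.ext (by rw [shift_apply, add_zero, ih, ha0])
      rw [Fin.le_def] at h3
      omega
    · rw [if_neg hpar] at ih
      rw [if_pos (by omega)]
      have h3 : (a 1).rev ≤ a (n + 1) := (hadm n).1.apply_le (n := 1) fun i hi => by
        obtain rfl : i = 0 := by omega
        refine Fin.ext ?_
        rw [shift_apply, add_zero, reflSeq_apply, Fin.val_rev, ih, ha0]
        omega
      rw [Fin.le_def, Fin.val_rev] at h3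
      omega

end KomornikLoreti

/-! ### Free bits inside the band at the left endpoint. -/

section LowerBound

variable {M : ℕ} {q : ℝ} {a t x y : DigitSeq M}

theorem two_pow_le_prefixCount {X : Set (DigitSeq M)} {n N : ℕ} (G : (Fin n → Bool) → DigitSeq M)
    (hG : ∀ u, G u ∈ X) (hinj : ∀ u v, (∀ i < N, G u i = G v i) → u = v) :
    2 ^ n ≤ prefixCount X N := by
  have h1 : Function.Injective fun u => truncate N (G u) := fun u v h =>
    hinj u v (truncate_eq_iff.1 h)
  have h2 : (Set.range fun u => truncate N (G u)).ncard = 2 ^ n := by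
    rw [← Set.image_univ, Set.ncard_image_of_injective _ h1, Set.ncard_univ]
    simp
  rw [← h2]
  refine Set.ncard_le_ncard ?_ (finite_truncate_image X N)
  rintro _ ⟨u, rfl⟩
  exact ⟨_, hG u, rfl⟩

/-- The sequence of digits with the given values. -/
def ofNatSeq (f : ℕ → ℕ) (h : ∀ i, f i ≤ M) : DigitSeq M := fun i => ⟨f i, Nat.lt_succ_of_le (h i)⟩

theorem eq_of_toNat_eq {b c : Bool} (h : b.toNat = c.toNat) : b = c := by
  revert h
  cases b <;> cases c <;> simp

/-- Continue a finite sequence of bits by `false`. -/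
def extendBits {n : ℕ} (u : Fin n → Bool) (j : ℕ) : Bool := if h : j < n then u ⟨j, h⟩ else false

theorem extendBits_of_lt {n : ℕ} (u : Fin n → Bool) (j : Fin n) : extendBits u j = u j := by
  simp [extendBits]

theorem rep_plus_refl_initial {k : ℕ} (hk : 0 < a k) (i : ℕ) :
    (rep (plus (refl (initial a k))) i : ℕ) =
      if i % (k + 1) = k then M - a k + 1 else M - a (i % (k + 1)) := by
  have hl : refl (initial a k) (Fin.last k) < Fin.last M := by
    have : 0 < (a k : ℕ) := hk
    have h2 := (a k).2
    rw [Fin.lt_def, refl, Fin.val_rev, Fin.val_last]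
    change M + 1 - ((a k : ℕ) + 1) < M
    omega
  rw [rep]
  split_ifs with h
  · have h1 : (⟨i % (k + 1), Nat.mod_lt i (Nat.succ_pos k)⟩ : Fin (k + 1)) = Fin.last k :=
      Fin.ext h
    rw [h1, plus_last_val hl, refl, Fin.val_rev]
    change M + 1 - ((a k : ℕ) + 1) + 1 = _
    omega
  · rw [plus, Function.update_of_ne (fun he => h (congrArg Fin.val he)), refl, Fin.val_rev]
    change M + 1 - ((a (i % (k + 1)) : ℕ) + 1) = _
    omega

theorem mem_band_of_le {P : DigitSeq M → Prop} (hP : ∀ x, P x → LexLT x a)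
    (hs : ∀ x n, P x → P (shift n x)) (hr : ∀ x, P x → P (reflSeq x)) (hx : P x) : x ∈ band a :=
  fun n => ⟨hP _ (hs _ n hx), hP _ (hr _ (hs _ n hx))⟩

/-- If the first digit is K+1, this is irreducibility for the one-letter prefix, whose lowered
repetition is K^∞; a larger first digit decides at once. -/
theorem floor_lt_of_even {K : ℕ} (hK : M = 2 * K) (hirr : IsIrreducibleSeq a)
    (h0 : M < 2 * (a 0 : ℕ)) (ht : ∀ i, (t i : ℕ) = if i = 0 then K + 1 else K) : LexLT t a := by
  rcases (show K + 1 ≤ (a 0 : ℕ) by omega).lt_or_eq with h | h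
  · exact lexLT_of 0 (fun i hi => absurd hi (Nat.not_lt_zero i))
      (by rw [Fin.lt_def, ht, if_pos rfl]; exact h)
  · have hpos : 0 < a 0 := by rw [Fin.lt_def, Fin.val_zero]; omega
    have hlow := lowered_self hpos
    have hrev : (a 0).rev < a 0 := by rw [Fin.lt_def, Fin.val_rev]; omega
    have hfree : OverlapFree a 0 := fun i hi hov => by
      obtain rfl : i = 0 := by omega
      exact hrev.ne' (hov 0 (by omega))
    have hadm := lowered_mem_admissibleSeqs hirr.1 hfree hpos
      (by rw [Fin.le_def, Fin.val_rev]; omega) fun _ => hrev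
    convert hirr.2 0 hpos hadm using 1
    funext i
    refine Fin.ext ?_
    rw [ht, append]
    split_ifs with h1 h2 h2
    · subst h1; exact h
    · omega
    · omega
    · rw [rep_plus_refl_initial hpos, if_pos (Nat.mod_one _)]
      omega

/-- The main case is irreducibility for the prefix (K+1)(K+1), whose lowered repetition is
((K+1)K)^∞. -/
theorem floor_lt_of_odd {K : ℕ} (hK : M = 2 * K + 1) (hirr : IsIrreducibleSeq a)
    (h0 : M < 2 * (a 0 : ℕ)) (h1 : 2 * (a 0 : ℕ) = M + 1 → a 1 = a 0)
    (ht : ∀ i, (t i : ℕ) = if i = 0 ∨ i % 2 = 1 then K + 1 else K) : LexLT t a := by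
  rcases (show K + 1 ≤ (a 0 : ℕ) by omega).lt_or_eq with h | h
  · exact lexLT_of 0 (fun i hi => absurd hi (Nat.not_lt_zero i))
      (by rw [Fin.lt_def, ht, if_pos (Or.inl rfl)]; exact h)
  · have ha1 := h1 (by omega)
    have hpos : 0 < a 1 := by rw [ha1, Fin.lt_def, Fin.val_zero]; omega
    have hrev : (a 0).rev < a 0 := by rw [Fin.lt_def, Fin.val_rev]; omega
    have hfree : OverlapFree a 1 := fun i hi hov => by
      have := hov 0 (by omega)
      rcases (show i = 0 ∨ i = 1 by omega) with rfl | rfl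
      · exact hrev.ne' this
      · exact hrev.ne' (ha1 ▸ this)
    have hadm := lowered_mem_admissibleSeqs hirr.1 hfree hpos
      (by rw [lowered_of_lt zero_lt_one]; exact hrev.le) fun _ => hrev
    convert hirr.2 1 hpos hadm using 1
    funext i
    refine Fin.ext ?_
    rw [ht, append]
    by_cases hi : i < 1 + 1
    · rw [dif_pos hi, if_pos (by omega)]
      rcases (show i = 0 ∨ i = 1 by omega) with rfl | rfl
      · exact h
      · exact h.trans (congrArg Fin.val ha1.symm)
    · rw [dif_neg hi, rep_plus_refl_initial hpos, ha1]
      by_cases hp : i % 2 = 1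
      · rw [if_pos (Or.inr hp), if_pos (by omega)]
        omega
      · rw [if_neg (by omega), if_neg (by omega), show (i - (1 + 1)) % (1 + 1) = 0 by omega]
        omega

/-- The digits minus K are increments of a 0-1 sequence: after an increment +1 followed by zeros,
another +1 is impossible. -/
theorem le_floor_of_even {K : ℕ}
    (ht : ∀ i, (t i : ℕ) = if i = 0 then K + 1 else K) {s : ℕ → Bool}
    (hy : ∀ i, (y i : ℕ) + (s i).toNat = K + (s (i + 1)).toNat) : LexLE y t := by
  refine lexLE_of_forall fun p hag => ?_
  have hb : ∀ j, (s j).toNat ≤ 1 := fun j => Bool.toNat_le _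
  rw [Fin.le_def, ht]
  rcases Nat.eq_zero_or_pos p with rfl | hp
  · rw [if_pos rfl]
    have := hy 0
    have := hb (0 + 1)
    omega
  · rw [if_neg hp.ne']
    have key : ∀ j, 0 < j → j ≤ p → (s j).toNat = 1 := by
      intro j hj
      induction j, hj using Nat.le_induction with
      | base =>
        intro _
        have h1 := ht 0
        rw [← hag 0 hp, if_pos rfl] at h1
        have h2 := hy 0
        have := hb (0 + 1)
        change (s (0 + 1)).toNat = 1
        omega
      | succ j hj ih =>
        intro hjp
        have h1 := ht j
        rw [← hag j (by omega), if_neg (by omega)] at h1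
        have h2 := hy j
        have := ih (by omega)
        omega
    have h1 := key p hp le_rfl
    have h2 := hy p
    have := hb (p + 1)
    omega

/-- Two consecutive K+1 at the start must straddle a boundary between complementary pairs. This
fixes the parity, and each later K+1 in an odd place has K as its partner. -/
theorem le_floor_of_odd {K e : ℕ}
    (ht : ∀ i, (t i : ℕ) = if i = 0 ∨ i % 2 = 1 then K + 1 else K)
    (hy : ∀ i, (y i : ℕ) ≤ K + 1)
    (hy' : ∀ i, i % 2 = e % 2 → (y i : ℕ) + y (i + 1) = 2 * K + 1) : LexLE y t := by
  refine lexLE_of_forall fun p hag => ?_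
  rw [Fin.le_def, ht]
  split_ifs with h
  · exact hy p
  · obtain ⟨p, rfl⟩ : ∃ r, p = r + 2 := ⟨p - 2, by omega⟩
    have h0 := ht 0
    have h1 := ht 1
    have h2 := ht (p + 1)
    rw [← hag 0 (by omega), if_pos (Or.inl rfl)] at h0
    rw [← hag 1 (by omega), if_pos (Or.inr rfl)] at h1
    rw [← hag (p + 1) (by omega), if_pos (by omega)] at h2
    by_cases he : e % 2 = 0
    · have : (y 0 : ℕ) + y 1 = 2 * K + 1 := hy' 0 (by omega)
      omega
    · have : (y (p + 1) : ℕ) + y (p + 2) = 2 * K + 1 := hy' (p + 1) (by omega)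
      omega

theorem two_pow_le_of_even {K : ℕ} (hM : 1 ≤ M) (hK : M = 2 * K) (hirr : IsIrreducibleSeq a)
    (h0 : M < 2 * (a 0 : ℕ)) (n : ℕ) : 2 ^ n ≤ prefixCount (band a) n := by
  have hlt := floor_lt_of_even (t := ofNatSeq (fun i => if i = 0 then K + 1 else K) fun i => by
    split_ifs <;> omega) hK hirr h0 fun i => rfl
  -- The leading `false` anchors the increments, so n digits determine all n bits.
  let s : (Fin n → Bool) → ℕ → Bool := fun u j => if j = 0 then false else extendBits u (j - 1)
  have hb : ∀ b : Bool, b.toNat ≤ 1 := fun b => Bool.toNat_le _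
  let G : (Fin n → Bool) → DigitSeq M := fun u =>
    ofNatSeq (fun i => K + (s u (i + 1)).toNat - (s u i).toNat) fun i => by
      have := hb (s u (i + 1))
      omega
  have hGv : ∀ u i, (G u i : ℕ) + (s u i).toNat = K + (s u (i + 1)).toNat := fun u i => by
    change K + (s u (i + 1)).toNat - (s u i).toNat + (s u i).toNat = _
    have := hb (s u i)
    omega
  refine two_pow_le_prefixCount G (fun u => ?_) fun u v huv => ?_
  · refine mem_band_of_le
      (P := fun y => ∃ s : ℕ → Bool, ∀ i, (y i : ℕ) + (s i).toNat = K + (s (i + 1)).toNat)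
      ?_ ?_ ?_ ⟨s u, hGv u⟩
    · rintro y ⟨s, hs⟩
      exact (le_floor_of_even (K := K) (fun i => rfl) hs).trans_lt hlt
    · rintro y p ⟨s, hs⟩
      exact ⟨fun i => s (p + i), fun i => hs (p + i)⟩
    · rintro y ⟨s, hs⟩
      refine ⟨fun i => !(s i), fun i => ?_⟩
      have h1 := hs i
      have h2 := (y i).2
      rw [reflSeq_apply, Fin.val_rev]
      cases hsi : s i <;> cases hsi' : s (i + 1) <;>
        simp only [hsi, hsi', Bool.toNat_true, Bool.toNat_false, Bool.not_true, Bool.not_false]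
          at h1 ⊢ <;> omega
  · have key : ∀ j ≤ n, s u j = s v j := by
      intro j
      induction j with
      | zero => intro _; rfl
      | succ j ih =>
        intro hj
        have h1 := hGv u j
        have h2 := hGv v j
        rw [huv j (by omega), ih (by omega)] at h1
        exact eq_of_toNat_eq (by omega)
    funext j
    have := key (j + 1) (by omega)
    simpa [s, extendBits_of_lt] using this

theorem two_pow_le_of_odd {K : ℕ} (hK : M = 2 * K + 1) (hirr : IsIrreducibleSeq a)
    (h0 : M < 2 * (a 0 : ℕ)) (h1 : 2 * (a 0 : ℕ) = M + 1 → a 1 = a 0) (n : ℕ) :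
    2 ^ n ≤ prefixCount (band a) (2 * n) := by
  have hlt := floor_lt_of_odd
    (t := ofNatSeq (fun i => if i = 0 ∨ i % 2 = 1 then K + 1 else K) fun i => by
      split_ifs <;> omega) hK hirr h0 h1 fun i => rfl
  have hb : ∀ b : Bool, b.toNat ≤ 1 := fun b => Bool.toNat_le _
  -- Even places carry the bits; each odd place complements the digit after it.
  let f : (Fin n → Bool) → ℕ → ℕ := fun u i => if i % 2 = 0 then K + (extendBits u (i / 2)).toNat
    else K + 1 - (extendBits u (i / 2 + 1)).toNat
  have hf : ∀ u i, K ≤ f u i ∧ f u i ≤ K + 1 := fun u i => by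
    have h1 := hb (extendBits u (i / 2))
    have h2 := hb (extendBits u (i / 2 + 1))
    simp only [f]
    split_ifs <;> omega
  let G : (Fin n → Bool) → DigitSeq M := fun u => ofNatSeq (f u) fun i => by
    have := hf u i
    omega
  refine two_pow_le_prefixCount G (fun u => ?_) fun u v huv => ?_
  · refine mem_band_of_le
      (P := fun y => (∀ i, K ≤ (y i : ℕ) ∧ (y i : ℕ) ≤ K + 1) ∧
        ∃ e, ∀ i, i % 2 = e % 2 → (y i : ℕ) + y (i + 1) = 2 * K + 1)
      ?_ ?_ ?_ ⟨hf u, 1, fun i hi => ?_⟩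
    · rintro y ⟨hy, e, he⟩
      exact (le_floor_of_odd (K := K) (fun i => rfl) (fun i => (hy i).2) he).trans_lt hlt
    · rintro y p ⟨hy, e, he⟩
      exact ⟨fun i => hy (p + i), e + p, fun i hi => he (p + i) (by omega)⟩
    · rintro y ⟨hy, e, he⟩
      refine ⟨fun i => ?_, e, fun i hi => ?_⟩
      · have := hy i
        rw [reflSeq_apply, Fin.val_rev]
        omega
      · have h1 := he i hi
        have h2 := hy i
        have h3 := hy (i + 1)
        rw [reflSeq_apply, reflSeq_apply, Fin.val_rev, Fin.val_rev]
        omega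
    · change f u i + f u (i + 1) = 2 * K + 1
      have h2 := hb (extendBits u (i / 2 + 1))
      simp only [f]
      rw [if_neg (by omega), if_pos (by omega), show (i + 1) / 2 = i / 2 + 1 by omega]
      omega
  · funext j
    have h2 : f u (2 * j) = f v (2 * j) := congrArg Fin.val (huv (2 * j) (by omega))
    simp only [f] at h2
    rw [if_pos (by omega), if_pos (by omega), show 2 * (j : ℕ) / 2 = j by omega,
      extendBits_of_lt, extendBits_of_lt] at h2
    exact eq_of_toNat_eq (by omega)

/-- For a block of length one, a bit per two letters is too few. But `a` is then constant with digit
at least K+1, so all words in K and K+1 are available. -/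
theorem two_pow_le_of_odd_const {K : ℕ} (hK : M = 2 * K + 1) (h0 : M < 2 * (a 0 : ℕ))
    (hper : shift 1 a = a) (n : ℕ) : 2 ^ n ≤ prefixCount (band a) n := by
  have hconst : ∀ i, a i = a 0 := by
    intro i
    induction i with
    | zero => rfl
    | succ i ih =>
      have := congrFun hper i
      rw [shift_apply, Nat.add_comm 1 i] at this
      rw [this, ih]
  have hb : ∀ b : Bool, b.toNat ≤ 1 := fun b => Bool.toNat_le _
  -- The alternating tail keeps every shift different from the constant `a`, which gives strict
  -- inequalities.
  let f : (Fin n → Bool) → ℕ → ℕ := fun u i => if i < n then K + (extendBits u i).toNat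
    else K + i % 2
  have hf : ∀ u i, K ≤ f u i ∧ f u i ≤ K + 1 := fun u i => by
    have h1 := hb (extendBits u i)
    simp only [f]
    split_ifs <;> omega
  let G : (Fin n → Bool) → DigitSeq M := fun u => ofNatSeq (f u) fun i => by
    have := hf u i
    omega
  refine two_pow_le_prefixCount G (fun u => ?_) fun u v huv => ?_
  · refine mem_band_of_le
      (P := fun y => (∀ i, K ≤ (y i : ℕ) ∧ (y i : ℕ) ≤ K + 1) ∧
        ∃ N, ∀ i, N ≤ i → (y i : ℕ) + y (i + 1) = 2 * K + 1)
      ?_ ?_ ?_ ⟨hf u, n, fun i hi => ?_⟩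
    · rintro y ⟨hy, N, hN⟩
      have hle : LexLE y a := lexLE_of_forall fun i _ => by
        rw [hconst i, Fin.le_def]
        have := (hy i).2
        omega
      refine ((lexLE_iff _ _).1 hle).resolve_right fun h => ?_
      have h1 := hN N le_rfl
      rw [h, hconst N, hconst (N + 1)] at h1
      omega
    · rintro y p ⟨hy, N, hN⟩
      exact ⟨fun i => hy (p + i), N, fun i hi => hN (p + i) (by omega)⟩
    · rintro y ⟨hy, N, hN⟩
      refine ⟨fun i => ?_, N, fun i hi => ?_⟩
      · have := hy i
        rw [reflSeq_apply, Fin.val_rev]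
        omega
      · have h1 := hN i hi
        have h2 := hy i
        have h3 := hy (i + 1)
        rw [reflSeq_apply, reflSeq_apply, Fin.val_rev, Fin.val_rev]
        omega
    · change f u i + f u (i + 1) = 2 * K + 1
      simp only [f]
      rw [if_neg (by omega), if_neg (by omega)]
      omega
  · funext j
    have h2 : f u j = f v j := congrArg Fin.val (huv j j.2)
    simp only [f] at h2
    rw [if_pos j.2, if_pos j.2, extendBits_of_lt, extendBits_of_lt] at h2
    exact eq_of_toNat_eq (by omega)

theorem exists_two_pow_le {k : ℕ} (hM : 1 ≤ M) (hirr : IsIrreducibleSeq a)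
    (hper : shift (k + 1) a = a) (h0 : M < 2 * (a 0 : ℕ))
    (h1 : 2 * (a 0 : ℕ) = M + 1 → a 1 = a 0) :
    ∃ d, 0 < d ∧ d ≤ k + 1 ∧ ∀ n, 2 ^ n ≤ prefixCount (band a) (d * n) := by
  rcases Nat.even_or_odd' M with ⟨K, hK | hK⟩
  · exact ⟨1, one_pos, by omega, fun n => by
      rw [one_mul]; exact two_pow_le_of_even hM hK hirr h0 n⟩
  · rcases Nat.eq_zero_or_pos k with rfl | hk
    · exact ⟨1, one_pos, by omega, fun n => by
        rw [one_mul]; exact two_pow_le_of_odd_const hK h0 hper n⟩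
    · exact ⟨2, two_pos, by omega, two_pow_le_of_odd hK hirr h0 h1⟩

theorem log_two_div_le {X : Set (DigitSeq M)} {d m : ℕ} (hd : 0 < d) (hdm : d ≤ m)
    (hX : ∀ n, 2 ^ n ≤ prefixCount X (d * n)) {h : ℝ}
    (hg : GrowsAtMost (fun n => (prefixCount X n : ℝ)) h) : Real.log 2 / m ≤ h := by
  have hd' : (0 : ℝ) < d := by exact_mod_cast hd
  have hlog : 0 ≤ Real.log 2 := Real.log_nonneg one_le_two
  have h1 : Real.log 2 / m ≤ Real.log 2 / d := by gcongr
  refine h1.trans (le_of_growsAtMost_exp ((hg.const_mul zero_le_two).mono fun n => ?_))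
  have h2 : (n : ℝ) ≤ d * ((n / d : ℕ) + 1) := by
    exact_mod_cast (Nat.lt_mul_div_succ n hd).le
  have h3 : Real.log 2 / d * n ≤ Real.log ((2 : ℝ) ^ (n / d + 1)) := by
    rw [Real.log_pow]
    calc Real.log 2 / d * n ≤ Real.log 2 / d * (d * ((n / d : ℕ) + 1)) := by gcongr
      _ = _ := by push_cast; field_simp
  calc Real.exp (Real.log 2 / d * n) ≤ (2 : ℝ) ^ (n / d + 1) := by
        rw [← Real.exp_log (show (0 : ℝ) < 2 ^ (n / d + 1) by positivity)]
        exact Real.exp_le_exp.2 h3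
    _ = 2 * 2 ^ (n / d) := by ring
    _ ≤ 2 * prefixCount X n := by
      gcongr
      exact_mod_cast (hX _).trans (prefixCount_mono_right X (Nat.mul_div_le n d))

end LowerBound

/-! ### Entropy of the univoque set, and the two endpoints. -/

section Main

variable {M : ℕ} {q : ℝ} {a b : DigitSeq M}

theorem univoque_nonempty (hq : 1 < q) : (symbolicUnivoqueSet M q).Nonempty := by
  refine ⟨fun _ => 0, mem_symbolicUnivoqueSet.2 fun y hy => ?_⟩
  rw [expansionValue_const_zero] at hy
  funext i
  by_contra hi
  exact (expansionValue_pos hq hi).ne' hy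

/-- If `band b ⊆ 𝐔_q`, the growth of `band b` and that of the band of `α(q)` are the same, then
this is the entropy of `𝐔_q`. -/
theorem tendsto_growthRate_univoque (hq : 1 < q) (hqM : q ≤ M + 1) (ha : IsQuasiGreedy q a)
    (hb : (band b).Nonempty) (hsub : band b ⊆ band a) {h : ℝ} (hh : 0 ≤ h)
    (hlim : Tendsto (growthRate (band b)) atTop (𝓝 h))
    (hg : GrowsAtMost (fun n => (prefixCount (band a) n : ℝ)) h) :
    Tendsto (growthRate (symbolicUnivoqueSet M q)) atTop (𝓝 h) := by
  have hval := ha.value_shift_le_of_lt hq hqM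
  obtain ⟨h', hh'⟩ := exists_tendsto_growthRate (univoque_nonempty (M := M) hq)
    fun x hx n => univoque_shift hq hx n
  have h1 : h' ≤ h := le_of_growsAtMost_prefixCount (univoque_nonempty hq) hh'
    (growsAtMost_of_band (ha.shift_le hq hqM)
      (fun x hx => ⟨fun n hn => univoque_shift_lt hq hqM ha.1.1 hval hx hn,
        fun n hn => univoque_reflSeq_shift_lt hq hqM ha.1.1 hval hx hn⟩) hh hg)
  have h2 : h ≤ h' := le_of_growsAtMost_prefixCount hb hlim
    ((growsAtMost_prefixCount (univoque_nonempty hq) hh').mono fun n => by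
      exact_mod_cast prefixCount_mono
        (hsub.trans (band_subset_univoque hq ha.1.1 ha.1.2)) n)
  rwa [le_antisymm h1 h2] at hh'

end Main

end BetaExp

theorem proposition4p5 (M : ℕ) (hM : 1 ≤ M) (pL pR : ℝ)
    (h : BetaExp.IsIrreducibleInterval M pL pR) :
    BetaExp.EntropyExists (BetaExp.symbolicUnivoqueSet M pL) ∧
      BetaExp.EntropyExists (BetaExp.symbolicUnivoqueSet M pR) ∧
      BetaExp.entropyFunction M pR = BetaExp.entropyFunction M pL := by
  open BetaExp in
  obtain ⟨⟨hL, hLR, hR⟩, k, w, hw, hqL, hirr, hqR⟩ := h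
  have hL1 : 1 < pL := (one_le_qKL hM).trans_lt hL
  set a := rep w with ha
  set a' := append (plus w) (rep (refl w)) with ha'
  have hper : shift (k + 1) a = a := rep_shift w
  have hag : ∀ i < k, a' i = a i := fun i hi => by
    rw [ha', append, dif_pos (by omega), ha, rep_apply w (show i < k + 1 by omega), plus,
      Function.update_of_ne (by simp [Fin.ext_iff, hi.ne])]
  have hk : (a' k : ℕ) = a k + 1 := by
    rw [ha', append, dif_pos (by omega), ha, rep_apply w (Nat.lt_succ_self k)]
    exact plus_last_val hw
  have hsh : shift (k + 1) a' = reflSeq a := by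
    funext i
    rw [shift_apply, ha', append, dif_neg (by omega), Nat.add_sub_cancel_left]
    rfl
  have haa' : LexLT a a' := lexLT_of k (fun i hi => (hag i hi).symm) (by rw [Fin.lt_def]; omega)
  have h0 := head_gt_of_qKL_lt hM hirr.1 hL hqL.1.1
  have h1 := second_of_qKL_lt hM hirr.1 hL hqL.1.1
  have hrev : (a 0).rev < a 0 := by rw [Fin.lt_def, Fin.val_rev]; omega
  -- If the first digit is (M+1)/2, the second equals it, whereas reflection would make the second
  -- digit smaller.
  have hne := shift_ne_reflSeq_of_isIrreducibleSeq hirr hrev fun h2 h3 => by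
    have h4 := congrFun h3 0
    rw [shift_apply, add_zero, h1 h2] at h4
    exact hrev.ne' h4
  obtain ⟨c, hc, hca⟩ := exists_mem_band_agree (Nat.succ_pos k) hper hirr.1 hrev hne
  have hband : (band a).Nonempty := ⟨c, hc⟩
  obtain ⟨h, hlim⟩ := exists_tendsto_growthRate hband fun x hx n => band_shift hx n
  have hg := growsAtMost_prefixCount hband hlim
  obtain ⟨d, hd, hdk, htwo⟩ := exists_two_pow_le hM hirr hper h0 h1
  have hlog := log_two_div_le hd hdk htwo hg
  have hh : 0 ≤ h := (div_nonneg (Real.log_nonneg one_le_two) (Nat.cast_nonneg _)).trans hlog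
  -- Both endpoints are compared with the same set `band a`, so both limits equal h.
  have hlimL := tendsto_growthRate_univoque hL1 (hLR.trans hR) hqL hband subset_rfl hh hlim hg
  have hlimR := tendsto_growthRate_univoque (hL1.trans_le hLR) hR hqR hband (band_mono haa') hh
    hlim (growsAtMost_band_right hper hag hk hsh hirr.1 hc hca hlog hg)
  exact ⟨⟨h, hlimL⟩, ⟨h, hlimR⟩, hlimR.limUnder_eq.trans hlimL.limUnder_eq.symm⟩
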